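/- A \emph{time series} of length $n\ge 1$ is a sequence $x=(x_1,\dots,x_n)\in\mathbb{Q}^n$. A \emph{warping path} of order $m\times n$ is a sequence $p=(p_1,\dots,p_L)$ of pairs in $\{1,\dots,m\}\times\{1,\dots,n\}$ with $p_1=(1,1)$, $p_L=(m,n)$ and $p_{\ell+1}-p_\ell\in\{(1,0),(0,1),(1,1)\}$ for all $1\le \ell<L$. For time series $x$ of length $m$ and $y$ of length $n$ let \[\operatorname{dtw}(x,y)=\min_p\sqrt{\sum_{(i,j)\in p}(x_i-y_j)^2},\] the minimum being over all warping paths $p$ of order $m\times n$ and the sum over all members of the sequence $p$. The problem Weighted DTW-Mean is: given $k\ge 1$ time series $x^{(1)},\dots,x^{(k)}$ and rational weights $w_1,\dots,w_k\ge 0$, find a time series $z$ that minimizes $F_w(z)=\sum_{j=1}^k w_j\operatorname{dtw}(z,x^{(j)})^2$ over all rational time series of all finite lengths. \textbf{Theorem.} Weighted DTW-Mean for $k$ input time series is solvable with $O(n^{2k+1}2^k k)$ arithmetical operations, where $n$ is the maximum length of any input time series. Precisely: there are one program for a unit-cost random access machine with exact rational arithmetic, and one constant $c$, such that for all $k\ge1$,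 all time series $x^{(1)},\dots,x^{(k)}$ with maximum length $n$, and all rational weights $w_1,\dots,w_k\ge0$, the program halts after at most $c\,n^{2k+1}2^k k$ steps and outputs a minimizer of $F_w$. Every arithmetical operation $+,-,\cdot,/$ on rationals, every comparison, every index operation and every memory access counts as a step. -/

import Mathlib

namespace DTW

/-! ### Time series, warping paths and the dtw-distance -/

/-- A finite univariate rational time series (of positive length).
Positions are numbered from `0`. -/
structure TimeSeries where
  length : ℕ
  length_pos : 0 < length
  val : Fin length → ℚ

/-- The difference `b - a` is one of `(1,0)`, `(0,1)`, `(1,1)`. -/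
def WarpStep {m n : ℕ} (a b : Fin m × Fin n) : Prop :=
  ((b.1 : ℕ) = a.1 + 1 ∧ (b.2 : ℕ) = a.2) ∨
  ((b.1 : ℕ) = a.1 ∧ (b.2 : ℕ) = a.2 + 1) ∨
  ((b.1 : ℕ) = a.1 + 1 ∧ (b.2 : ℕ) = a.2 + 1)

/-- Warping paths of order `m × n`: from the first pair of positions to the last one,
by steps in `{(1,0), (0,1), (1,1)}`. -/
structure IsWarpingPath {m n : ℕ} (p : List (Fin m × Fin n)) : Prop where
  head : ∃ a, p.head? = some a ∧ (a.1 : ℕ) = 0 ∧ (a.2 : ℕ) = 0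
  last : ∃ a, p.getLast? = some a ∧ (a.1 : ℕ) + 1 = m ∧ (a.2 : ℕ) + 1 = n
  step : p.IsChain WarpStep

/-- The cost of aligning `x` and `y` along `p`. -/
def pathCost (x y : TimeSeries) (p : List (Fin x.length × Fin y.length)) : ℚ :=
  (p.map fun q => (x.val q.1 - y.val q.2) ^ 2).sum

/-- The dtw-distance: the minimum of `√(C_p(x,y))` over all warping paths `p`.
(There are finitely many of them, and at least one, so the infimum is a minimum.) -/
noncomputable def dtw (x y : TimeSeries) : ℝ :=
  sInf {r : ℝ | ∃ p : List (Fin x.length × Fin y.length),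
    IsWarpingPath p ∧ r = √(pathCost x y p : ℝ)}

/-- The weighted Fréchet function `F_w(z) = ∑ j, w_j * dtw(z, x_j)²`. -/
noncomputable def frechet {k : ℕ} (x : Fin k → TimeSeries) (w : Fin k → ℚ) (z : TimeSeries) : ℝ :=
  ∑ j, (w j : ℝ) * dtw z (x j) ^ 2

/-- `z` is a weighted mean: it minimizes `F_w` over all rational time series, of any length. -/
def IsMean {k : ℕ} (x : Fin k → TimeSeries) (w : Fin k → ℚ) (z : TimeSeries) : Prop :=
  ∀ z' : TimeSeries, frechet x w z ≤ frechet x w z'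

/-- The maximum length of the series of a sample. -/
def maxLength {k : ℕ} (x : Fin k → TimeSeries) : ℕ :=
  Finset.univ.sup fun j => (x j).length

/-! ### A random access machine over the rationals, with unit costs

Programs are finite texts of a structured language. The memory consists of arrays of natural
numbers, used for control and addressing, and of arrays of rational numbers. The two kinds of
values are never converted into one another. -/

/-- Memory: `nat a i` and `rat a i` are the cells with index `i` of the natural-number and of
the rational array named `a`. -/
structure Mem where
  nat : ℕ → ℕ → ℕ
  rat : ℕ → ℕ → ℚ

/-- Write a cell of a natural-number array. -/
def Mem.setNat (s : Mem) (a i v : ℕ) : Mem :=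
  { s with nat := Function.update s.nat a (Function.update (s.nat a) i v) }

/-- Write a cell of a rational array. -/
def Mem.setRat (s : Mem) (a i : ℕ) (v : ℚ) : Mem :=
  { s with rat := Function.update s.rat a (Function.update (s.rat a) i v) }

/-- Index expressions; array names are fixed in the program, positions are computed. -/
inductive NExp where
  | const (c : ℕ)
  | get (a : ℕ) (i : NExp)
  | add (e f : NExp)
  | sub (e f : NExp)
  | mul (e f : NExp)

/-- Value of an index expression (subtraction is truncated). -/
def NExp.eval (s : Mem) : NExp → ℕ
  | const c => c
  | get a i => s.nat a (i.eval s)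
  | add e f => e.eval s + f.eval s
  | sub e f => e.eval s - f.eval s
  | mul e f => e.eval s * f.eval s

/-- Every constant, memory access and operation costs one. -/
def NExp.cost : NExp → ℕ
  | const _ => 1
  | get _ i => i.cost + 1
  | add e f => e.cost + f.cost + 1
  | sub e f => e.cost + f.cost + 1
  | mul e f => e.cost + f.cost + 1

/-- Rational expressions: the four arithmetical operations. -/
inductive QExp where
  | const (c : ℚ)
  | get (a : ℕ) (i : NExp)
  | add (e f : QExp)
  | sub (e f : QExp)
  | mul (e f : QExp)
  | div (e f : QExp)

/-- Value of a rational expression (exact arithmetic; a quotient by `0` has the value `0`). -/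
def QExp.eval (s : Mem) : QExp → ℚ
  | const c => c
  | get a i => s.rat a (i.eval s)
  | add e f => e.eval s + f.eval s
  | sub e f => e.eval s - f.eval s
  | mul e f => e.eval s * f.eval s
  | div e f => e.eval s / f.eval s

/-- Every constant, memory access and arithmetical operation costs one. -/
def QExp.cost : QExp → ℕ
  | const _ => 1
  | get _ i => i.cost + 1
  | add e f => e.cost + f.cost + 1
  | sub e f => e.cost + f.cost + 1
  | mul e f => e.cost + f.cost + 1
  | div e f => e.cost + f.cost + 1

/-- Tests of branches and loops. -/
inductive Test where
  | natLt (e f : NExp)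
  | ratLt (e f : QExp)
  | not (b : Test)
  | and (b d : Test)

/-- When a test is passed. -/
def Test.holds (s : Mem) : Test → Prop
  | natLt e f => e.eval s < f.eval s
  | ratLt e f => e.eval s < f.eval s
  | not b => ¬ b.holds s
  | and b d => b.holds s ∧ d.holds s

/-- Every comparison and Boolean operation costs one. -/
def Test.cost : Test → ℕ
  | natLt e f => e.cost + f.cost + 1
  | ratLt e f => e.cost + f.cost + 1
  | not b => b.cost + 1
  | and b d => b.cost + d.cost + 1

/-- Programs. -/
inductive Program where
  | skip
  | setNat (a : ℕ) (i e : NExp)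
  | setRat (a : ℕ) (i : NExp) (e : QExp)
  | seq (P Q : Program)
  | ite (b : Test) (P Q : Program)
  | while (b : Test) (P : Program)

/-- `Exec P s t s'`: started in memory `s`, the program `P` halts in memory `s'` after
exactly `t` steps. -/
inductive Exec : Program → Mem → ℕ → Mem → Prop where
  | skip (s : Mem) : Exec .skip s 1 s
  | setNat (a : ℕ) (i e : NExp) (s : Mem) :
      Exec (.setNat a i e) s (i.cost + e.cost + 1) (s.setNat a (i.eval s) (e.eval s))
  | setRat (a : ℕ) (i : NExp) (e : QExp) (s : Mem) :
      Exec (.setRat a i e) s (i.cost + e.cost + 1) (s.setRat a (i.eval s) (e.eval s))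
  | seq {P Q : Program} {s s' s'' : Mem} {t u : ℕ} :
      Exec P s t s' → Exec Q s' u s'' → Exec (.seq P Q) s (t + u) s''
  | iteTrue {b : Test} {P Q : Program} {s s' : Mem} {t : ℕ} :
      b.holds s → Exec P s t s' → Exec (.ite b P Q) s (b.cost + t) s'
  | iteFalse {b : Test} {P Q : Program} {s s' : Mem} {t : ℕ} :
      ¬ b.holds s → Exec Q s t s' → Exec (.ite b P Q) s (b.cost + t) s'
  | whileTrue {b : Test} {P : Program} {s s' s'' : Mem} {t u : ℕ} :
      b.holds s → Exec P s t s' → Exec (.while b P) s' u s'' →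
      Exec (.while b P) s (b.cost + t + u) s''
  | whileFalse {b : Test} {P : Program} {s : Mem} :
      ¬ b.holds s → Exec (.while b P) s b.cost s

/-- The input: `nat 0` holds `k`, `nat 1` holds the `k` lengths, `rat 0` holds the `k` weights,
`rat 1` holds the entries of the series, one series after the other; all other cells are `0`. -/
def inputMem {k : ℕ} (x : Fin k → TimeSeries) (w : Fin k → ℚ) : Mem where
  nat a i :=
    if a = 0 then [k].getD i 0
    else if a = 1 then (List.ofFn fun j => (x j).length).getD i 0
    else 0
  rat a i :=
    if a = 0 then (List.ofFn w).getD i 0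
    else if a = 1 then (List.ofFn fun j => List.ofFn (x j).val).flatten.getD i 0
    else 0

/-- The output: `nat 2` holds the length of `z` at position `0`, and `rat 2` holds the entries
of `z`, from position `0` on. -/
def IsOutput (s : Mem) (z : TimeSeries) : Prop :=
  s.nat 2 0 = z.length ∧ ∀ i : Fin z.length, s.rat 2 i = z.val i

end DTW

/-! A warping path from `z` to `x` gives each entry of `z` an interval of positions of `x`. The
intervals cover all positions in order, and each one starts at the last position of its predecessor
or one further (`StepPath.align`, `Align.stepPath`). With `k` series, the weighted cost is therefore
a sum over the entries of `z`, and the summand of an entry depends only on that entry and its `k`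
intervals. It is a quadratic polynomial in the entry, minimized by the weighted mean of the covered
values, with a minimum computable from three sums (`segCost_segMean`, `segMin_le`).

What remains is a shortest path problem. A state is the tuple of right ends of the `k` intervals of
the last entry, coded by its base-`n` digits as a number below `n ^ k`; a step is a tuple of `k`
bits telling whether the next interval shares a position with the last one. Componentwise order
implies numerical order (`le_of_digit_le`), so states can be processed in increasing order. A
transition from a state to itself adds an entry at nonnegative cost and can be omitted; the digit
sum then grows with each entry, which bounds the length of the computed series (`Tables.index_le`).
The table values are attained by the series stored in back pointers (`reach_series`), and no series
of any length is cheaper (`opt_le_of_reach`). Since `dtw` squared is the least of finitely many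
rational alignment costs, this yields a mean (`isMean_of_reach`).

There are at most `n ^ k * n ^ k` pairs of states and `2 ^ k` steps for each pair, and every triple
needs `O(k * n)` operations for its sums; all other work is dominated by this product
(`total_time_le`). The machine has no integer division, so digits are tabulated beforehand
(`runs_digitsProg`). The program is verified by a Hoare-style logic: weakest preconditions for
loop-free code, `runs_forLoop` for loops, and `Exec.agree` as frame rule. -/

namespace DTW

/-! ### A program logic with running times -/

/-- Started in `s`, the program `P` halts after at most `T` steps, in a memory satisfying `R`. -/
def Runs (P : Program) (s : Mem) (T : ℕ) (R : Mem → Prop) : Prop :=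
  ∃ t s', Exec P s t s' ∧ t ≤ T ∧ R s'

/-- The arrays of natural numbers a program may write to. -/
def Program.natWrites : Program → List ℕ
  | skip => []
  | setNat a _ _ => [a]
  | setRat _ _ _ => []
  | seq P Q => P.natWrites ++ Q.natWrites
  | ite _ P Q => P.natWrites ++ Q.natWrites
  | .while _ P => P.natWrites

/-- The arrays of rational numbers a program may write to. -/
def Program.ratWrites : Program → List ℕ
  | skip => []
  | setNat _ _ _ => []
  | setRat a _ _ => [a]
  | seq P Q => P.ratWrites ++ Q.ratWrites
  | ite _ P Q => P.ratWrites ++ Q.ratWrites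
  | .while _ P => P.ratWrites

/-- Two memories differ at most in the natural-number arrays `A` and the rational arrays `B`. -/
structure Agree (A B : List ℕ) (s s' : Mem) : Prop where
  nat : ∀ a, a ∉ A → s'.nat a = s.nat a
  rat : ∀ a, a ∉ B → s'.rat a = s.rat a

theorem Agree.refl (A B : List ℕ) (s : Mem) : Agree A B s s :=
  ⟨fun _ _ => rfl, fun _ _ => rfl⟩

theorem Agree.trans {A B : List ℕ} {s s' s'' : Mem} (h : Agree A B s s') (h' : Agree A B s' s'') :
    Agree A B s s'' :=
  ⟨fun a ha => (h'.nat a ha).trans (h.nat a ha), fun a ha => (h'.rat a ha).trans (h.rat a ha)⟩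

theorem Agree.mono {A B A' B' : List ℕ} {s s' : Mem} (h : Agree A B s s') (hA : A ⊆ A')
    (hB : B ⊆ B') : Agree A' B' s s' :=
  ⟨fun a ha => h.nat a fun h' => ha (hA h'), fun a ha => h.rat a fun h' => ha (hB h')⟩

@[simp] theorem setNat_rat (s : Mem) (a i v : ℕ) : (s.setNat a i v).rat = s.rat := rfl

@[simp] theorem setRat_nat (s : Mem) (a i : ℕ) (v : ℚ) : (s.setRat a i v).nat = s.nat := rfl

theorem setNat_nat_of_ne (s : Mem) {a b : ℕ} (i v : ℕ) (h : b ≠ a) :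
    (s.setNat a i v).nat b = s.nat b :=
  Function.update_of_ne h _ _

theorem setNat_nat_self (s : Mem) (a i v : ℕ) :
    (s.setNat a i v).nat a = Function.update (s.nat a) i v :=
  Function.update_self _ _ _

theorem setRat_rat_of_ne (s : Mem) {a b : ℕ} (i : ℕ) (v : ℚ) (h : b ≠ a) :
    (s.setRat a i v).rat b = s.rat b :=
  Function.update_of_ne h _ _

theorem setRat_rat_self (s : Mem) (a i : ℕ) (v : ℚ) :
    (s.setRat a i v).rat a = Function.update (s.rat a) i v :=
  Function.update_self _ _ _

theorem agree_setNat (s : Mem) (a i v : ℕ) (B : List ℕ) : Agree [a] B s (s.setNat a i v) :=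
  ⟨fun b hb => setNat_nat_of_ne s i v (by simpa using hb), fun _ _ => rfl⟩

/-- Frame rule. Array names are fixed in the program text, so the arrays that may change are read
off syntactically, and all others can be left out of the invariants. -/
theorem Exec.agree {P : Program} {s s' : Mem} {t : ℕ} (h : Exec P s t s') :
    Agree P.natWrites P.ratWrites s s' := by
  induction h with
  | skip s => exact Agree.refl _ _ _
  | setNat a i e s => exact agree_setNat ..
  | setRat a i e s =>
    exact ⟨fun _ _ => rfl, fun b hb => setRat_rat_of_ne s _ _ (by simpa [Program.ratWrites] using hb)⟩
  | seq _ _ h h' =>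
    exact (h.mono (List.subset_append_left ..) (List.subset_append_left ..)).trans
      (h'.mono (List.subset_append_right ..) (List.subset_append_right ..))
  | iteTrue _ _ h => exact h.mono (List.subset_append_left ..) (List.subset_append_left ..)
  | iteFalse _ _ h => exact h.mono (List.subset_append_right ..) (List.subset_append_right ..)
  | whileTrue _ _ _ h h' => exact h.trans h'
  | whileFalse _ => exact Agree.refl _ _ _

theorem Runs.mono {P : Program} {s : Mem} {T T' : ℕ} {R R' : Mem → Prop} (h : Runs P s T R)
    (hT : T ≤ T') (hR : ∀ s', Agree P.natWrites P.ratWrites s s' → R s' → R' s') :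
    Runs P s T' R' := by
  obtain ⟨t, s', he, ht, hr⟩ := h
  exact ⟨t, s', he, ht.trans hT, hR _ he.agree hr⟩

theorem Runs.seq {P Q : Program} {s : Mem} {T T' : ℕ} {R : Mem → Prop}
    (h : Runs P s T fun s' => Runs Q s' T' R) : Runs (.seq P Q) s (T + T') R := by
  obtain ⟨t, s', he, ht, u, s'', he', hu, hr⟩ := h
  exact ⟨t + u, s'', .seq he he', add_le_add ht hu, hr⟩

/-- Weakest precondition of a program without loops. -/
def Program.wp : Program → (Mem → Prop) → Mem → Prop
  | skip, R, s => R s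
  | setNat a i e, R, s => R (s.setNat a (i.eval s) (e.eval s))
  | setRat a i e, R, s => R (s.setRat a (i.eval s) (e.eval s))
  | seq P Q, R, s => P.wp (Q.wp R) s
  | ite b P Q, R, s => (b.holds s → P.wp R s) ∧ (¬ b.holds s → Q.wp R s)
  | .while _ _, _, _ => False

/-- A bound for the running time of a program without loops. -/
def Program.bound : Program → ℕ
  | skip => 1
  | setNat _ i e => i.cost + e.cost + 1
  | setRat _ i e => i.cost + e.cost + 1
  | seq P Q => P.bound + Q.bound
  | ite b P Q => b.cost + (P.bound + Q.bound)
  | .while _ _ => 0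

theorem runs_of_wp {P : Program} {s : Mem} {R : Mem → Prop} (h : P.wp R s) :
    Runs P s P.bound R := by
  induction P generalizing s R with
  | skip => exact ⟨_, _, .skip s, le_rfl, h⟩
  | setNat a i e => exact ⟨_, _, .setNat a i e s, le_rfl, h⟩
  | setRat a i e => exact ⟨_, _, .setRat a i e s, le_rfl, h⟩
  | seq P Q hP hQ => exact Runs.seq ((hP h).mono le_rfl fun s' _ h' => hQ h')
  | ite b P Q hP hQ =>
    by_cases hb : b.holds s
    · obtain ⟨t, s', he, ht, hr⟩ := hP (h.1 hb)
      exact ⟨_, s', .iteTrue hb he, Nat.add_le_add_left (ht.trans (Nat.le_add_right ..)) _, hr⟩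
    · obtain ⟨t, s', he, ht, hr⟩ := hQ (h.2 hb)
      exact ⟨_, s', .iteFalse hb he, Nat.add_le_add_left (ht.trans (Nat.le_add_left ..)) _, hr⟩
  -- The precondition `wp` of a loop is `False`, so its bound `0` is harmless.
  | _ => exact h.elim

/-- The scalar variable stored in cell `0` of the natural-number array `a`. -/
abbrev nvar (a : ℕ) : NExp := .get a (.const 0)

/-- The scalar variable stored in cell `0` of the rational array `a`. -/
abbrev qvar (a : ℕ) : QExp := .get a (.const 0)

/-- Run `B` for the values `0, 1, …` of the scalar `v`, as long as they are less than `e`. -/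
def forLoop (v : ℕ) (e : NExp) (B : Program) : Program :=
  .seq (.setNat v (.const 0) (.const 0))
    (.while (.natLt (nvar v) e)
      (.seq B (.setNat v (.const 0) (.add (nvar v) (.const 1)))))

/-- The bound `e` is evaluated anew before every round, so its value must survive all writes of the
body and of the counter. A round costs the body, `e.cost + 3` for the test and `6` for the
increment; the final `e.cost + 6` pays for the initial assignment and the failing test. -/
theorem runs_forLoop {v : ℕ} {e : NExp} {B : Program} {s : Mem} {N T : ℕ} (I : ℕ → Mem → Prop)
    (hv : v ∉ B.natWrites)
    (he : ∀ s', Agree (v :: B.natWrites) B.ratWrites s s' → e.eval s' = N)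
    (h0 : I 0 (s.setNat v 0 0))
    (hs : ∀ i s', i < N → Agree (v :: B.natWrites) B.ratWrites s s' → s'.nat v 0 = i → I i s' →
      Runs B s' T fun s'' => I (i + 1) (s''.setNat v 0 (i + 1))) :
    Runs (forLoop v e B) s (N * (T + e.cost + 9) + e.cost + 6) (I N) := by
  have hA : ∀ s' x, Agree (v :: B.natWrites) B.ratWrites s' (s'.setNat v 0 x) := fun s' x =>
    (agree_setNat s' v 0 x B.ratWrites).mono (by simp) (by simp)
  have key : ∀ d i s', i + d = N → Agree (v :: B.natWrites) B.ratWrites s s' → s'.nat v 0 = i →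
      I i s' → Runs (.while (.natLt (nvar v) e)
        (.seq B (.setNat v (.const 0) (.add (nvar v) (.const 1))))) s'
        (d * (T + e.cost + 9) + (e.cost + 3)) (I N) := by
    intro d
    induction d with
    | zero =>
      intro i s' hi ha hvi hI
      refine ⟨_, s', .whileFalse ?_, ?_, ?_⟩
      · simp only [Test.holds, NExp.eval, he s' ha, hvi]; omega
      · simp only [Test.cost, NExp.cost]; omega
      · rwa [← show i = N by omega]
    | succ d ih =>
      intro i s' hi ha hvi hI
      obtain ⟨t, s₁, h₁, ht, hI₁⟩ := hs i s' (by omega) ha hvi hI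
      have hv₁ : s₁.nat v 0 = i := by rw [h₁.agree.nat v hv, hvi]
      have hx := Exec.setNat v (.const 0) (.add (nvar v) (.const 1)) s₁
      simp only [NExp.eval, NExp.cost, hv₁] at hx
      have ha₁ : Agree (v :: B.natWrites) B.ratWrites s (s₁.setNat v 0 (i + 1)) :=
        (ha.trans (h₁.agree.mono (by simp) (by simp))).trans (hA _ _)
      obtain ⟨u, s₂, h₂, hu, hI₂⟩ := ih (i + 1) _ (by omega) ha₁
        (by simp [setNat_nat_self]) hI₁
      refine ⟨_, s₂, .whileTrue ?_ (.seq h₁ hx) h₂, ?_, hI₂⟩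
      · simp only [Test.holds, NExp.eval, he s' ha, hvi]; omega
      · simp only [Test.cost, NExp.cost]
        have : (d + 1) * (T + e.cost + 9) = d * (T + e.cost + 9) + (T + e.cost + 9) := by ring
        omega
  have h := key N 0 _ (by omega) (hA s 0) (by simp [setNat_nat_self]) h0
  refine (Runs.seq (T := 3) ⟨3, _, .setNat v (.const 0) (.const 0) s, le_rfl, h⟩).mono (by omega)
    fun _ _ h => h

/-! ### Warping paths as alignments of entries to intervals -/

/-- `StepPath z x i j v`: some sequence of warping steps from `(0, 0)` to `(i, j)` has cost `v`. -/
inductive StepPath (z x : ℕ → ℚ) : ℕ → ℕ → ℚ → Prop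
  | start : StepPath z x 0 0 ((z 0 - x 0) ^ 2)
  | left {i j : ℕ} {v : ℚ} :
      StepPath z x i j v → StepPath z x (i + 1) j (v + (z (i + 1) - x j) ^ 2)
  | right {i j : ℕ} {v : ℚ} :
      StepPath z x i j v → StepPath z x i (j + 1) (v + (z i - x (j + 1)) ^ 2)
  | both {i j : ℕ} {v : ℚ} :
      StepPath z x i j v → StepPath z x (i + 1) (j + 1) (v + (z (i + 1) - x (j + 1)) ^ 2)

theorem StepPath.exists (z x : ℕ → ℚ) (i j : ℕ) : ∃ v, StepPath z x i j v := by
  have h : ∃ v, StepPath z x i 0 v := by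
    induction i with
    | zero => exact ⟨_, .start⟩
    | succ i ih => exact ih.imp' _ fun _ => .left
  induction j with
  | zero => exact h
  | succ j ih => exact ih.imp' _ fun _ => .right

/-- Each value at a cell comes from one of at most three neighbouring cells. Finiteness turns the
infimum in `dtw` into a minimum. -/
theorem StepPath.finite (z x : ℕ → ℚ) (i j : ℕ) : {v | StepPath z x i j v}.Finite := by
  induction i generalizing j with
  | zero =>
    induction j with
    | zero =>
      refine (Set.finite_singleton ((z 0 - x 0) ^ 2)).subset ?_
      rintro v ⟨⟩; rfl
    | succ j ih =>
      refine (ih.image (· + (z 0 - x (j + 1)) ^ 2)).subset ?_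
      rintro v (_ | _ | h | _); exact ⟨_, h, rfl⟩
  | succ i ih =>
    induction j with
    | zero =>
      refine ((ih 0).image (· + (z (i + 1) - x 0) ^ 2)).subset ?_
      rintro v (_ | h | _ | _); exact ⟨_, h, rfl⟩
    | succ j ih' =>
      refine (((ih (j + 1)).image (· + (z (i + 1) - x (j + 1)) ^ 2)).union
        ((ih'.image (· + (z (i + 1) - x (j + 1)) ^ 2)).union
        ((ih j).image (· + (z (i + 1) - x (j + 1)) ^ 2)))).subset ?_
      rintro v (_ | h | h | h)
      · exact .inl ⟨_, h, rfl⟩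
      · exact .inr (.inl ⟨_, h, rfl⟩)
      · exact .inr (.inr ⟨_, h, rfl⟩)

/-- `Align z x i p v`: the entries `z 0, …, z i` can be aligned to intervals that cover
`0, …, p`, consecutive intervals sharing at most one position, with cost `v`. -/
inductive Align (z x : ℕ → ℚ) : ℕ → ℕ → ℚ → Prop
  | start (p : ℕ) : Align z x 0 p (∑ t ∈ Finset.Ico 0 (p + 1), (x t - z 0) ^ 2)
  | step {i q p c : ℕ} {v : ℚ} : Align z x i q v → c ≤ 1 → q + c ≤ p →
      Align z x (i + 1) p (v + ∑ t ∈ Finset.Ico (q + c) (p + 1), (x t - z (i + 1)) ^ 2)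

theorem Align.congr {z z' x : ℕ → ℚ} {i p : ℕ} {v : ℚ} (h : Align z x i p v)
    (hz : ∀ t ≤ i, z t = z' t) : Align z' x i p v := by
  induction h with
  | start p => rw [hz 0 le_rfl]; exact .start p
  | step h hc hp ih =>
    rw [hz _ le_rfl]
    exact .step (ih fun t ht => hz t (ht.trans (Nat.le_succ _))) hc hp

theorem Align.extend {z x : ℕ → ℚ} {i p : ℕ} {v : ℚ} (h : Align z x i p v) :
    Align z x i (p + 1) (v + (z i - x (p + 1)) ^ 2) := by
  cases h with
  | start p =>
    have := Align.start (z := z) (x := x) (p + 1)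
    rw [Finset.sum_Ico_succ_top (Nat.zero_le _)] at this
    rwa [← sub_sq_comm (x (p + 1))]
  | step h hc hp =>
    have := h.step hc (hp.trans (Nat.le_succ _))
    rw [Finset.sum_Ico_succ_top (by omega)] at this
    rwa [← sub_sq_comm (x (p + 1)), add_assoc]

/-- A `left` step opens an interval at the position already reached (`c = 0`), a `both` step opens
one at the next position (`c = 1`), and a `right` step lengthens the current interval. -/
theorem StepPath.align {z x : ℕ → ℚ} {i p : ℕ} {v : ℚ} (h : StepPath z x i p v) :
    Align z x i p v := by
  induction h with
  | start =>
    have := Align.start (z := z) (x := x) 0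
    rw [zero_add, Nat.Ico_zero_eq_range, Finset.sum_range_one] at this
    rwa [sub_sq_comm]
  | @left i j v _ ih =>
    have := ih.step (c := 0) (p := j) (by simp) (by simp)
    rw [add_zero, Nat.Ico_succ_singleton, Finset.sum_singleton] at this
    rwa [sub_sq_comm]
  | right _ ih => exact ih.extend
  | @both i j v _ ih =>
    have := ih.step (c := 1) (p := j + 1) le_rfl le_rfl
    rw [Nat.Ico_succ_singleton, Finset.sum_singleton] at this
    rwa [sub_sq_comm]

/-- Each new interval is opened by one step, `left` or `both` according to `c`, and then filled by
`right` steps; hence the inner induction on the excess length `d`. -/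
theorem Align.stepPath {z x : ℕ → ℚ} {i p : ℕ} {v : ℚ} (h : Align z x i p v) :
    StepPath z x i p v := by
  induction h with
  | start p =>
    induction p with
    | zero => simpa [sub_sq_comm] using StepPath.start (z := z) (x := x)
    | succ p ih =>
      rw [Finset.sum_Ico_succ_top (Nat.zero_le _), sub_sq_comm (x (p + 1))]
      exact ih.right
  | @step i q p c v _ hc hp ih =>
    obtain ⟨d, rfl⟩ := Nat.exists_eq_add_of_le hp
    clear hp
    induction d with
    | zero =>
      rw [add_zero, Nat.Ico_succ_singleton, Finset.sum_singleton, sub_sq_comm]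
      obtain rfl | rfl : c = 0 ∨ c = 1 := by omega
      · exact ih.left
      · exact ih.both
    | succ d ihd =>
      rw [← add_assoc, Finset.sum_Ico_succ_top (by omega), sub_sq_comm (x (q + c + d + 1)),
        ← add_assoc]
      exact ihd.right

/-- The entries of a time series, continued by `0`. -/
def TimeSeries.entry (x : TimeSeries) (i : ℕ) : ℚ :=
  if h : i < x.length then x.val ⟨i, h⟩ else 0

@[simp] theorem TimeSeries.entry_coe (x : TimeSeries) (i : Fin x.length) :
    x.entry i = x.val i := by
  simp [TimeSeries.entry]

/-- The cost of a nonempty list of pairs of positions that starts at `(0, 0)` and proceeds by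
warping steps is the cost of a step path to its last pair. -/
theorem stepPath_of_list {z x : TimeSeries} (p : List (Fin z.length × Fin x.length))
    (a : Fin z.length × Fin x.length)
    (hd : ∃ b, (p ++ [a]).head? = some b ∧ (b.1 : ℕ) = 0 ∧ (b.2 : ℕ) = 0)
    (hs : (p ++ [a]).IsChain WarpStep) :
    StepPath z.entry x.entry a.1 a.2 (pathCost z x (p ++ [a])) := by
  induction p using List.reverseRecOn generalizing a with
  | nil =>
    obtain ⟨b, hb, h1, h2⟩ := hd
    obtain rfl : a = b := by simpa using hb
    have e : pathCost z x ([] ++ [a]) = (z.entry a.1 - x.entry a.2) ^ 2 := by simp [pathCost]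
    rw [e, h1, h2]
    exact .start
  | append_singleton p b ih =>
    have hab : WarpStep b a := by
      rw [List.append_assoc] at hs
      simpa using (List.isChain_append.1 hs).2.1
    have h := ih b (by simpa [List.head?_append] using hd) (List.isChain_append.1 hs).1
    have e : pathCost z x (p ++ [b] ++ [a])
        = pathCost z x (p ++ [b]) + (z.entry a.1 - x.entry a.2) ^ 2 := by
      simp [pathCost, add_assoc]
    rw [e]
    rcases hab with ⟨h1, h2⟩ | ⟨h1, h2⟩ | ⟨h1, h2⟩ <;> rw [h1, h2]
    · exact h.left
    · exact h.right
    · exact h.both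

/-- The list grows at its end. The pair `a` is tied to `i` and `j` only through the values of its
coordinates, so that its predecessor can be formed by subtraction inside `Fin`. -/
theorem StepPath.exists_list {z x : TimeSeries} {i j : ℕ} {v : ℚ}
    (h : StepPath z.entry x.entry i j v) (a : Fin z.length × Fin x.length)
    (h1 : (a.1 : ℕ) = i) (h2 : (a.2 : ℕ) = j) :
    ∃ p : List (Fin z.length × Fin x.length),
      (∃ b, (p ++ [a]).head? = some b ∧ (b.1 : ℕ) = 0 ∧ (b.2 : ℕ) = 0) ∧
      (p ++ [a]).IsChain WarpStep ∧ v = pathCost z x (p ++ [a]) := by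
  have snoc : ∀ (b a : Fin z.length × Fin x.length) {v : ℚ}, WarpStep b a →
      (∃ p : List (Fin z.length × Fin x.length),
        (∃ b', (p ++ [b]).head? = some b' ∧ (b'.1 : ℕ) = 0 ∧ (b'.2 : ℕ) = 0) ∧
        (p ++ [b]).IsChain WarpStep ∧ v = pathCost z x (p ++ [b])) →
      ∃ p : List (Fin z.length × Fin x.length),
        (∃ b', (p ++ [a]).head? = some b' ∧ (b'.1 : ℕ) = 0 ∧ (b'.2 : ℕ) = 0) ∧
        (p ++ [a]).IsChain WarpStep ∧
        v + (z.entry a.1 - x.entry a.2) ^ 2 = pathCost z x (p ++ [a]) := by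
    rintro b a v ha ⟨p, hd, hc, rfl⟩
    refine ⟨p ++ [b], by simpa [List.head?_append] using hd, ?_, ?_⟩
    · exact List.isChain_append.2 ⟨hc, by simp, by simpa using ha⟩
    · simp [pathCost, add_assoc]
  induction h generalizing a with
  | start => exact ⟨[], by simpa using ⟨h1, h2⟩, by simp, by
      simp only [pathCost, List.nil_append, List.map_cons, List.map_nil, List.sum_singleton,
        ← TimeSeries.entry_coe, h1, h2]⟩
  | left _ ih =>
    rw [← h1, ← h2]
    exact snoc (⟨a.1 - 1, by omega⟩, a.2) a (.inl ⟨by simp only []; omega, rfl⟩)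
      (ih _ (by simp only []; omega) h2)
  | right _ ih =>
    rw [← h1, ← h2]
    exact snoc (a.1, ⟨a.2 - 1, by omega⟩) a (.inr (.inl ⟨rfl, by simp only []; omega⟩))
      (ih _ h1 (by simp only []; omega))
  | both _ ih =>
    rw [← h1, ← h2]
    exact snoc (⟨a.1 - 1, by omega⟩, ⟨a.2 - 1, by omega⟩) a
      (.inr (.inr ⟨by simp only []; omega, by simp only []; omega⟩))
      (ih _ (by simp only []; omega) (by simp only []; omega))

theorem dtw_eq (z x : TimeSeries) : dtw z x = sInf ((fun v : ℚ => √(v : ℝ)) ''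
    {v | StepPath z.entry x.entry (z.length - 1) (x.length - 1) v}) := by
  have hz := z.length_pos
  have hx := x.length_pos
  unfold dtw
  congr 1
  ext r
  constructor
  · rintro ⟨p, hp, rfl⟩
    obtain ⟨a, ha, h1, h2⟩ := hp.last
    obtain ⟨p, rfl⟩ := List.getLast?_eq_some_iff.1 ha
    refine ⟨_, ?_, rfl⟩
    have := stepPath_of_list p a hp.head hp.step
    rwa [show (a.1 : ℕ) = z.length - 1 by omega, show (a.2 : ℕ) = x.length - 1 by omega] at this
  · rintro ⟨v, hv, rfl⟩
    obtain ⟨p, hd, hc, rfl⟩ := StepPath.exists_list hv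
      (⟨z.length - 1, by omega⟩, ⟨x.length - 1, by omega⟩) rfl rfl
    exact ⟨_, ⟨hd, ⟨_, List.getLast?_concat .., Nat.sub_add_cancel hz, Nat.sub_add_cancel hx⟩, hc⟩,
      rfl⟩

theorem Align.nonneg {z x : ℕ → ℚ} {i p : ℕ} {v : ℚ} (h : Align z x i p v) : 0 ≤ v := by
  induction h with
  | start p => exact Finset.sum_nonneg fun _ _ => sq_nonneg _
  | step _ _ _ ih => exact add_nonneg ih (Finset.sum_nonneg fun _ _ => sq_nonneg _)

theorem dtw_sq_le {z x : TimeSeries} {v : ℚ}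
    (h : Align z.entry x.entry (z.length - 1) (x.length - 1) v) : dtw z x ^ 2 ≤ (v : ℝ) := by
  have h0 : (0 : ℝ) ≤ v := by exact_mod_cast h.nonneg
  have h1 : dtw z x ≤ √(v : ℝ) := by
    rw [dtw_eq]
    refine csInf_le ⟨0, ?_⟩ ⟨v, h.stepPath, rfl⟩
    rintro _ ⟨_, _, rfl⟩
    exact Real.sqrt_nonneg _
  have h2 : 0 ≤ dtw z x := by
    rw [dtw_eq]
    refine Real.sInf_nonneg ?_
    rintro _ ⟨_, _, rfl⟩
    exact Real.sqrt_nonneg _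
  calc (dtw z x ^ 2 : ℝ) ≤ √(v : ℝ) ^ 2 := by gcongr
    _ = (v : ℝ) := Real.sq_sqrt h0

/-- A nonempty finite set contains its infimum, and squaring undoes the root because alignment costs
are nonnegative. -/
theorem exists_align_eq_dtw_sq (z x : TimeSeries) :
    ∃ v : ℚ, Align z.entry x.entry (z.length - 1) (x.length - 1) v ∧ dtw z x ^ 2 = (v : ℝ) := by
  have hf := (StepPath.finite z.entry x.entry (z.length - 1) (x.length - 1)).image
    fun v : ℚ => √(v : ℝ)
  have hne : ((fun v : ℚ => √(v : ℝ)) ''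
      {v | StepPath z.entry x.entry (z.length - 1) (x.length - 1) v}).Nonempty :=
    (StepPath.exists ..).imp' _ fun v hv => ⟨v, hv, rfl⟩
  obtain ⟨v, hv, he⟩ := hne.csInf_mem hf
  have hal := StepPath.align hv
  have h0 : (0 : ℝ) ≤ v := by exact_mod_cast hal.nonneg
  exact ⟨v, hal, by rw [dtw_eq, ← he, Real.sq_sqrt h0]⟩

/-! ### The recursion -/

/-! ### Coding tuples by digits -/

/-- Digit `j` of `P` in base `b`. -/
def digit (b P j : ℕ) : ℕ := P / b ^ j % b

theorem digit_lt {b : ℕ} (hb : 0 < b) (P j : ℕ) : digit b P j < b := Nat.mod_lt _ hb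

theorem digit_zero (b P : ℕ) : digit b P 0 = P % b := by simp [digit]

theorem digit_succ (b P j : ℕ) : digit b P (j + 1) = digit b (P / b) j := by
  rw [digit, digit, pow_succ', Nat.div_div_eq_div_mul]

/-- The number with the digits `d 0, …, d (k - 1)` in base `b`. -/
def ofDigitFun (b k : ℕ) (d : ℕ → ℕ) : ℕ := ∑ j ∈ Finset.range k, d j * b ^ j

theorem ofDigitFun_succ' (b k : ℕ) (d : ℕ → ℕ) :
    ofDigitFun b (k + 1) d = d 0 + b * ofDigitFun b k fun j => d (j + 1) := by
  rw [ofDigitFun, Finset.sum_range_succ', ofDigitFun, Finset.mul_sum, add_comm]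
  congr 1
  · simp
  · exact Finset.sum_congr rfl fun j _ => by ring

theorem ofDigitFun_lt {b k : ℕ} {d : ℕ → ℕ} (hd : ∀ j < k, d j < b) : ofDigitFun b k d < b ^ k := by
  induction k generalizing d with
  | zero => simp [ofDigitFun]
  | succ k ih =>
    rw [ofDigitFun_succ']
    have h1 := ih (d := fun j => d (j + 1)) fun j hj => hd _ (by omega)
    have h2 := hd 0 (by omega)
    calc _ < b + b * ofDigitFun b k (fun j => d (j + 1)) := by omega
      _ = b * (ofDigitFun b k (fun j => d (j + 1)) + 1) := by ring
      _ ≤ b * b ^ k := Nat.mul_le_mul_left _ h1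
      _ = b ^ (k + 1) := by ring

theorem digit_ofDigitFun {b k : ℕ} {d : ℕ → ℕ} (hd : ∀ j < k, d j < b) {j : ℕ} (hj : j < k) :
    digit b (ofDigitFun b k d) j = d j := by
  induction k generalizing d j with
  | zero => omega
  | succ k ih =>
    have h2 := hd 0 (by omega)
    rw [ofDigitFun_succ']
    cases j with
    | zero => rw [digit_zero, Nat.add_mul_mod_self_left, Nat.mod_eq_of_lt h2]
    | succ j =>
      rw [digit_succ, Nat.add_mul_div_left _ _ (by omega), Nat.div_eq_of_lt h2, zero_add]
      exact ih (d := fun j => d (j + 1)) (fun j hj => hd _ (by omega)) (by omega)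

theorem ofDigitFun_digit {b k P : ℕ} (hP : P < b ^ k) : ofDigitFun b k (digit b P) = P := by
  induction k generalizing P with
  | zero => simp [ofDigitFun] at hP ⊢; omega
  | succ k ih =>
    rw [ofDigitFun_succ', digit_zero]
    simp only [digit_succ]
    have : P / b < b ^ k := Nat.div_lt_of_lt_mul (by rwa [← pow_succ'])
    rw [show (fun j => digit b (P / b) j) = digit b (P / b) from rfl, ih this, Nat.mod_add_div]

/-- Both numbers are sums of digits times place values, which compare term by term. This is why
numerical order meets every predecessor of a state first. -/
theorem le_of_digit_le {b k P Q : ℕ} (hP : P < b ^ k) (hQ : Q < b ^ k)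
    (h : ∀ j < k, digit b Q j ≤ digit b P j) : Q ≤ P := by
  rw [← ofDigitFun_digit hP, ← ofDigitFun_digit hQ]
  exact Finset.sum_le_sum fun j hj => Nat.mul_le_mul_right _ (h j (Finset.mem_range.1 hj))

/-! ### Weighted cost of aligning one entry to `k` intervals -/

section Segments

variable (k : ℕ) (w : ℕ → ℚ) (X : ℕ → ℕ → ℚ)

/-- The total weight of the entries of `k` sequences in the intervals from `a j` to `b j`. -/
def segWeight (a b : ℕ → ℕ) : ℚ :=
  ∑ j ∈ Finset.range k, ∑ _t ∈ Finset.Ico (a j) (b j + 1), w j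

/-- The weighted sum of the entries in the intervals from `a j` to `b j`. -/
def segSum (a b : ℕ → ℕ) : ℚ :=
  ∑ j ∈ Finset.range k, ∑ t ∈ Finset.Ico (a j) (b j + 1), w j * X j t

/-- The weighted sum of the squares of the entries in the intervals from `a j` to `b j`. -/
def segSq (a b : ℕ → ℕ) : ℚ :=
  ∑ j ∈ Finset.range k, ∑ t ∈ Finset.Ico (a j) (b j + 1), w j * X j t * X j t

/-- The cost of aligning one entry `m` to the intervals from `a j` to `b j`. -/
def segCost (a b : ℕ → ℕ) (m : ℚ) : ℚ :=
  ∑ j ∈ Finset.range k, w j * ∑ t ∈ Finset.Ico (a j) (b j + 1), (X j t - m) ^ 2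

/-- The least cost of aligning one entry to the intervals from `a j` to `b j`. -/
def segMin (a b : ℕ → ℕ) : ℚ :=
  segSq k w X a b - segSum k w X a b * segSum k w X a b / segWeight k w a b

/-- The entry of least cost. -/
def segMean (a b : ℕ → ℕ) : ℚ := segSum k w X a b / segWeight k w a b

variable {k w X}

theorem segCost_eq (a b : ℕ → ℕ) (m : ℚ) : segCost k w X a b m =
    segSq k w X a b - 2 * m * segSum k w X a b + m ^ 2 * segWeight k w a b := by
  simp only [segCost, segSq, segSum, segWeight, Finset.mul_sum, ← Finset.sum_add_distrib,
    ← Finset.sum_sub_distrib]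
  exact Finset.sum_congr rfl fun j _ => Finset.sum_congr rfl fun t _ => by ring

/-- Nonnegative weights of total zero all vanish on the intervals, so the linear coefficient of the
cost vanishes together with the quadratic one. -/
theorem segSum_eq_zero {a b : ℕ → ℕ} (hw : ∀ j < k, 0 ≤ w j) (h : segWeight k w a b = 0) :
    segSum k w X a b = 0 := by
  have hnn : ∀ j ∈ Finset.range k, 0 ≤ ∑ _t ∈ Finset.Ico (a j) (b j + 1), w j := fun j hj =>
    Finset.sum_nonneg fun _ _ => hw j (Finset.mem_range.1 hj)
  refine Finset.sum_eq_zero fun j hj => Finset.sum_eq_zero fun t ht => ?_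
  have h1 := (Finset.sum_eq_zero_iff_of_nonneg hnn).1 h j hj
  have h2 := (Finset.sum_eq_zero_iff_of_nonneg fun _ _ => hw j (Finset.mem_range.1 hj)).1 h1 t ht
  rw [h2, zero_mul]

/-- Total weight zero is no exception: a quotient by zero is `0`, and both sides reduce to `segSq`.
-/
theorem segCost_segMean (a b : ℕ → ℕ) :
    segCost k w X a b (segMean k w X a b) = segMin k w X a b := by
  rw [segCost_eq, segMin, segMean]
  by_cases h : segWeight k w a b = 0
  · simp [h]
  · field_simp; ring

/-- Completing the square: the difference of the two sides is the total weight times the squared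
distance of `m` from the weighted mean. -/
theorem segMin_le {a b : ℕ → ℕ} (hw : ∀ j < k, 0 ≤ w j) (m : ℚ) :
    segMin k w X a b ≤ segCost k w X a b m := by
  rw [segCost_eq, segMin]
  by_cases h : segWeight k w a b = 0
  · simp [h, segSum_eq_zero hw h]
  · have h0 : 0 ≤ segWeight k w a b := Finset.sum_nonneg fun j hj =>
      Finset.sum_nonneg fun _ _ => hw j (Finset.mem_range.1 hj)
    have : 0 ≤ segWeight k w a b * (m - segSum k w X a b / segWeight k w a b) ^ 2 := by positivity
    have e : segWeight k w a b * (m - segSum k w X a b / segWeight k w a b) ^ 2 =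
        m ^ 2 * segWeight k w a b - 2 * m * segSum k w X a b +
          segSum k w X a b * segSum k w X a b / segWeight k w a b := by field_simp; ring
    linarith

theorem segCost_nonneg {a b : ℕ → ℕ} (hw : ∀ j < k, 0 ≤ w j) (m : ℚ) :
    0 ≤ segCost k w X a b m :=
  Finset.sum_nonneg fun j hj => mul_nonneg (hw j (Finset.mem_range.1 hj))
    (Finset.sum_nonneg fun _ _ => sq_nonneg _)

theorem segMin_congr {a a' b b' : ℕ → ℕ} (ha : ∀ j < k, a j = a' j) (hb : ∀ j < k, b j = b' j) :
    segMin k w X a b = segMin k w X a' b' := by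
  have h : ∀ f : ℕ → ℕ → ℚ, ∑ j ∈ Finset.range k, ∑ t ∈ Finset.Ico (a j) (b j + 1), f j t =
      ∑ j ∈ Finset.range k, ∑ t ∈ Finset.Ico (a' j) (b' j + 1), f j t := fun f =>
    Finset.sum_congr rfl fun j hj => by
      rw [ha j (Finset.mem_range.1 hj), hb j (Finset.mem_range.1 hj)]
  simp only [segMin, segSq, segSum, segWeight, h]

/-- The entries `z 0, …, z i` can be aligned to the parts up to `p j` of all sequences, with
weighted total cost `v`. -/
def Reach (k : ℕ) (w : ℕ → ℚ) (X : ℕ → ℕ → ℚ) (z : ℕ → ℚ) (i : ℕ) (p : ℕ → ℕ) (v : ℚ) : Prop :=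
  ∃ u : ℕ → ℚ, (∀ j < k, Align z (X j) i (p j) (u j)) ∧ v = ∑ j ∈ Finset.range k, w j * u j

theorem Reach.congr {z z' : ℕ → ℚ} {i : ℕ} {p p' : ℕ → ℕ} {v : ℚ} (h : Reach k w X z i p v)
    (hz : ∀ t ≤ i, z t = z' t) (hp : ∀ j < k, p j = p' j) : Reach k w X z' i p' v := by
  obtain ⟨u, hu, rfl⟩ := h
  exact ⟨u, fun j hj => hp j hj ▸ (hu j hj).congr hz, rfl⟩

theorem reach_start (z : ℕ → ℚ) (p : ℕ → ℕ) :
    Reach k w X z 0 p (segCost k w X (fun _ => 0) p (z 0)) :=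
  ⟨_, fun j _ => .start (p j), rfl⟩

theorem Reach.step {z : ℕ → ℚ} {i : ℕ} {q p c : ℕ → ℕ} {v : ℚ} (h : Reach k w X z i q v)
    (hc : ∀ j < k, c j ≤ 1) (hp : ∀ j < k, q j + c j ≤ p j) :
    Reach k w X z (i + 1) p (v + segCost k w X (fun j => q j + c j) p (z (i + 1))) := by
  obtain ⟨u, hu, rfl⟩ := h
  refine ⟨_, fun j hj => (hu j hj).step (hc j hj) (hp j hj), ?_⟩
  simp only [mul_add, Finset.sum_add_distrib, segCost]

theorem Reach.eq_start {z : ℕ → ℚ} {p : ℕ → ℕ} {v : ℚ} (h : Reach k w X z 0 p v) :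
    v = segCost k w X (fun _ => 0) p (z 0) := by
  obtain ⟨u, hu, rfl⟩ := h
  refine Finset.sum_congr rfl fun j hj => ?_
  generalize he : u j = y
  have hy := he ▸ hu j (Finset.mem_range.1 hj)
  cases hy
  rfl

/-- The alignments are inverted separately for each series; the previous ends and bits are then
collected by choice, with dummy values for `j ≥ k`. -/
theorem Reach.eq_step {z : ℕ → ℚ} {i : ℕ} {p : ℕ → ℕ} {v : ℚ} (h : Reach k w X z (i + 1) p v) :
    ∃ (q c : ℕ → ℕ) (v' : ℚ), Reach k w X z i q v' ∧ (∀ j < k, c j ≤ 1) ∧ (∀ j < k, q j + c j ≤ p j) ∧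
      v = v' + segCost k w X (fun j => q j + c j) p (z (i + 1)) := by
  obtain ⟨u, hu, rfl⟩ := h
  have : ∀ j, ∃ q c u', j < k → Align z (X j) i q u' ∧ c ≤ 1 ∧ q + c ≤ p j ∧
      u j = u' + ∑ t ∈ Finset.Ico (q + c) (p j + 1), (X j t - z (i + 1)) ^ 2 := by
    intro j
    by_cases hj : j < k
    · generalize he : u j = y
      have hy := he ▸ hu j hj
      cases hy with
      | step h hc hp => exact ⟨_, _, _, fun _ => ⟨h, hc, hp, rfl⟩⟩
    · exact ⟨0, 0, 0, fun h => absurd h hj⟩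
  choose q c u' h using this
  refine ⟨q, c, _, ⟨u', fun j hj => (h j hj).1, rfl⟩, fun j hj => (h j hj).2.1,
    fun j hj => (h j hj).2.2.1, ?_⟩
  rw [segCost, ← Finset.sum_add_distrib]
  exact Finset.sum_congr rfl fun j hj => by rw [(h j (Finset.mem_range.1 hj)).2.2.2, mul_add]

end Segments

/-! ### Tables of the recursion and their optimality -/

/-- Tables of optimal values, last entries, indices of last entries, and preceding states. -/
structure Tables where
  opt : ℕ → ℚ
  last : ℕ → ℚ
  index : ℕ → ℕ
  prev : ℕ → ℕ

/-- Write all four entries at `P`. -/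
def Tables.set (t : Tables) (P : ℕ) (v m : ℚ) (l q : ℕ) : Tables :=
  ⟨Function.update t.opt P v, Function.update t.last P m, Function.update t.index P l,
    Function.update t.prev P q⟩

/-- The tables agree up to `P`. -/
def Tables.AgreeOn (t t' : Tables) (P : ℕ) : Prop :=
  ∀ Q ≤ P, t'.opt Q = t.opt Q ∧ t'.last Q = t.last Q ∧ t'.index Q = t.index Q ∧
    t'.prev Q = t.prev Q

theorem Tables.agreeOn_set (t : Tables) {P Q : ℕ} (h : Q < P) (v m : ℚ) (l q : ℕ) :
    t.AgreeOn (t.set P v m l q) Q := by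
  intro R hR
  have : R ≠ P := by omega
  simp [Tables.set, Function.update_of_ne this]

section Recursion

variable (k n : ℕ) (w : ℕ → ℚ) (X : ℕ → ℕ → ℚ)

/-- From the state `Q`, with next intervals starting `c` further, the state `P` can be reached. -/
def Admissible (P Q c : ℕ) : Prop := ∀ j < k, digit n Q j + digit 2 c j ≤ digit n P j

/-- The least cost of one entry leading from `Q` to `P`. -/
def stepMin (P Q c : ℕ) : ℚ := segMin k w X (fun j => digit n Q j + digit 2 c j) (digit n P)

/-- The optimal entry leading from `Q` to `P`. -/
def stepMean (P Q c : ℕ) : ℚ := segMean k w X (fun j => digit n Q j + digit 2 c j) (digit n P)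

/-- The entries of the tables at `P` belong to a chain of states, and are optimal among the
predecessors allowed by `D`. -/
structure Partial (t : Tables) (P : ℕ) (D : ℕ → ℕ → Prop) : Prop where
  attained : (t.index P = 0 ∧ t.last P = segMean k w X (fun _ => 0) (digit n P) ∧
      t.opt P = segMin k w X (fun _ => 0) (digit n P)) ∨
    ∃ c, t.prev P < P ∧ c < 2 ^ k ∧ Admissible k n P (t.prev P) c ∧
      t.index P = t.index (t.prev P) + 1 ∧ t.last P = stepMean k n w X P (t.prev P) c ∧
      t.opt P = t.opt (t.prev P) + stepMin k n w X P (t.prev P) c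
  le_start : t.opt P ≤ segMin k w X (fun _ => 0) (digit n P)
  le_step : ∀ Q c, D Q c → Q < P → c < 2 ^ k → Admissible k n P Q c →
    t.opt P ≤ t.opt Q + stepMin k n w X P Q c

/-- The entries of the tables at `P` satisfy the recursion. -/
def Good (t : Tables) (P : ℕ) : Prop := Partial k n w X t P fun _ _ => True

variable {k n w X}

theorem Partial.mono {t : Tables} {P : ℕ} {D D' : ℕ → ℕ → Prop} (h : Partial k n w X t P D)
    (hD : ∀ Q c, Q < P → c < 2 ^ k → Admissible k n P Q c → D' Q c → D Q c) :
    Partial k n w X t P D' :=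
  ⟨h.attained, h.le_start, fun Q c hd hQ hc ha => h.le_step Q c (hD Q c hQ hc ha hd) hQ hc ha⟩

/-- Only entries at numbers up to `P` are consulted, because predecessors are smaller than `P`. -/
theorem Partial.congr {t t' : Tables} {P : ℕ} {D : ℕ → ℕ → Prop} (h : Partial k n w X t P D)
    (ht : t.AgreeOn t' P) : Partial k n w X t' P D := by
  obtain ⟨e1, e2, e3, e4⟩ := ht P le_rfl
  refine ⟨?_, ?_, fun Q c hd hQ hc ha => ?_⟩
  · rw [e1, e2, e3, e4]
    refine h.attained.imp id ?_
    rintro ⟨c, hq, h'⟩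
    obtain ⟨f1, f2, f3, f4⟩ := ht _ hq.le
    exact ⟨c, hq, by rwa [f1, f3]⟩
  · rw [e1]; exact h.le_start
  · rw [e1, (ht Q hQ.le).1]; exact h.le_step Q c hd hQ hc ha

theorem partial_set_start (t : Tables) (P q : ℕ) :
    Partial k n w X (t.set P (segMin k w X (fun _ => 0) (digit n P))
      (segMean k w X (fun _ => 0) (digit n P)) 0 q) P fun _ _ => False :=
  ⟨.inl (by simp [Tables.set]), by simp [Tables.set], fun _ _ h => h.elim⟩

theorem Partial.set_step {t : Tables} {P Q c : ℕ} {D : ℕ → ℕ → Prop} (h : Partial k n w X t P D)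
    (hQ : Q < P) (hc : c < 2 ^ k) (ha : Admissible k n P Q c)
    (hlt : t.opt Q + stepMin k n w X P Q c < t.opt P) :
    Partial k n w X (t.set P (t.opt Q + stepMin k n w X P Q c) (stepMean k n w X P Q c)
      (t.index Q + 1) Q) P fun Q' c' => D Q' c' ∨ (Q' = Q ∧ c' = c) := by
  refine ⟨.inr ⟨c, ?_⟩, ?_, ?_⟩
  · simp [Tables.set, hQ, hQ.ne, hc, ha]
  · simpa [Tables.set] using hlt.le.trans h.le_start
  · rintro Q' c' (hd | ⟨rfl, rfl⟩) hQ' hc' ha'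
    · simpa [Tables.set, hQ'.ne] using hlt.le.trans (h.le_step Q' c' hd hQ' hc' ha')
    · simp [Tables.set, hQ.ne]

/-- The pair can be ticked off without a write, either because it is not admissible or because it
brings no improvement. -/
theorem Partial.skip_step {t : Tables} {P Q c : ℕ} {D : ℕ → ℕ → Prop} (h : Partial k n w X t P D)
    (hlt : Admissible k n P Q c → ¬ t.opt Q + stepMin k n w X P Q c < t.opt P) :
    Partial k n w X t P fun Q' c' => D Q' c' ∨ (Q' = Q ∧ c' = c) := by
  refine ⟨h.attained, h.le_start, ?_⟩
  rintro Q' c' (hd | ⟨rfl, rfl⟩) hQ' hc' ha'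
  · exact h.le_step Q' c' hd hQ' hc' ha'
  · exact not_lt.1 (hlt ha')

/-- The series encoded in the tables at the state `P`. -/
def Tables.series (t : Tables) (P i : ℕ) : ℚ := t.last (t.prev^[t.index P - i] P)

/-- The digit sum strictly increases along the chain of predecessors: no digit decreases, and if
none increased, `le_of_digit_le` would contradict `prev P < P`. The bound controls the time for
writing the output. -/
theorem Tables.index_le {t : Tables} {P : ℕ} (hn : 0 < n) (hP : P < n ^ k)
    (ht : ∀ Q ≤ P, Good k n w X t Q) : t.index P ≤ k * (n - 1) := by
  have key : t.index P ≤ ∑ j ∈ Finset.range k, digit n P j := by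
    induction P using Nat.strong_induction_on with
    | _ P ih =>
      rcases (ht P le_rfl).attained with ⟨h, -⟩ | ⟨c, hq, -, ha, h, -⟩
      · omega
      · have h1 := ih _ hq (by omega) fun Q hQ => ht Q (by omega)
        have h2 : ∑ j ∈ Finset.range k, digit n (t.prev P) j < ∑ j ∈ Finset.range k, digit n P j := by
          refine Finset.sum_lt_sum (fun j hj => ?_) ?_
          · exact (Nat.le_add_right ..).trans (ha j (Finset.mem_range.1 hj))
          · by_contra hcon
            push Not at hcon
            have := le_of_digit_le (k := k) (hq.trans hP) hP fun j hj =>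
              hcon j (Finset.mem_range.2 hj)
            omega
        omega
  refine key.trans ?_
  calc _ ≤ ∑ _j ∈ Finset.range k, (n - 1) :=
        Finset.sum_le_sum fun j _ => Nat.le_sub_one_of_lt (digit_lt hn P j)
    _ = k * (n - 1) := by simp

/-- Soundness of the tables, by induction along `prev`: the series at `P` prolongs that of its
predecessor by one entry, and the recorded mean realizes `segMin` exactly. -/
theorem reach_series {t : Tables} {P : ℕ}
    (ht : ∀ Q ≤ P, Good k n w X t Q) :
    Reach k w X (t.series P) (t.index P) (digit n P) (t.opt P) := by
  induction P using Nat.strong_induction_on with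
  | _ P ih =>
    rcases (ht P le_rfl).attained with ⟨h1, h2, h3⟩ | ⟨c, hq, -, ha, h1, h2, h3⟩
    · rw [h1, h3, ← segCost_segMean, ← h2]
      have := reach_start (k := k) (w := w) (X := X) (t.series P) (digit n P)
      rwa [show t.series P 0 = t.last P by simp [Tables.series, h1]] at this
    · have h := ih _ hq fun Q hQ => ht Q (by omega)
      have h' := (h.congr (z' := t.series P) ?_ fun _ _ => rfl).step (c := digit 2 c)
        (p := digit n P) (fun j _ => Nat.le_of_lt_succ (digit_lt two_pos c j)) ha
      · rw [← h1, show t.series P (t.index P) = t.last P by simp [Tables.series], h2, stepMean,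
          segCost_segMean] at h'
        rw [h3]
        exact h'
      · intro i hi
        -- Reaching entry `i` from `P` takes one more application of `prev` than from the
        -- predecessor of `P`.
        rw [Tables.series, Tables.series, h1, Nat.succ_sub hi, Function.iterate_succ_apply]

/-- Optimality against series of every length, by induction on the last index `i`. The previous ends
`q` and the bits `c` are coded as numbers, for which the recursion gives an inequality. -/
theorem opt_le_of_reach {t : Tables} {N P : ℕ} (hn : 0 < n) (hw : ∀ j < k, 0 ≤ w j)
    (ht : ∀ Q ≤ N, Good k n w X t Q) (hPN : P ≤ N) (hP : P < n ^ k) {z : ℕ → ℚ} {i : ℕ} {v : ℚ}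
    (h : Reach k w X z i (digit n P) v) : t.opt P ≤ v := by
  induction i generalizing P v with
  | zero => exact h.eq_start ▸ (ht P hPN).le_start.trans (segMin_le hw _)
  | succ i ih =>
    obtain ⟨q, c, v', hr, hc, hp, rfl⟩ := h.eq_step
    have hq : ∀ j < k, q j < n := fun j hj =>
      ((Nat.le_add_right ..).trans (hp j hj)).trans_lt (digit_lt hn P j)
    have hqd : ∀ j < k, digit n (ofDigitFun n k q) j = q j := fun j hj => digit_ofDigitFun hq hj
    have hcd : ∀ j < k, digit 2 (ofDigitFun 2 k c) j = c j := fun j hj =>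
      digit_ofDigitFun (fun j hj => Nat.lt_succ_of_le (hc j hj)) hj
    have hQ := ofDigitFun_lt hq
    have hle : ofDigitFun n k q ≤ P := le_of_digit_le hP hQ fun j hj => by
      rw [hqd j hj]; exact (Nat.le_add_right ..).trans (hp j hj)
    have hv' := ih (hle.trans hPN) hQ (hr.congr (fun _ _ => rfl) fun j hj => (hqd j hj).symm)
    -- The tables have no transition from `P` to itself. None is needed, since such an entry only
    -- adds a nonnegative cost.
    rcases hle.eq_or_lt with he | hlt
    · rw [he] at hv'
      exact hv'.trans (le_add_of_nonneg_right (segCost_nonneg hw _))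
    · refine ((ht P hPN).le_step _ (ofDigitFun 2 k c) trivial hlt
        (ofDigitFun_lt fun j hj => Nat.lt_succ_of_le (hc j hj)) fun j hj => ?_).trans
        (add_le_add hv' ?_)
      · rw [hqd j hj, hcd j hj]; exact hp j hj
      · rw [stepMin, segMin_congr (a' := fun j => q j + c j) (b' := digit n P)
          (fun j hj => by rw [hqd j hj, hcd j hj]) fun _ _ => rfl]
        exact segMin_le hw _

end Recursion

/-! ### From optimal alignments to a mean -/

/-- Needed because the entries read from the machine's memory need not agree with the series beyond
its end; only positions up to `p` matter. -/
theorem Align.congr_right {z x x' : ℕ → ℚ} {i p : ℕ} {v : ℚ} (h : Align z x i p v)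
    (hx : ∀ t ≤ p, x t = x' t) : Align z x' i p v := by
  induction h with
  | start p =>
    rw [Finset.sum_congr rfl fun t ht => by rw [hx t (by simp at ht; omega)]]
    exact .start p
  | step h hc hp ih =>
    rw [Finset.sum_congr rfl fun t ht => by rw [hx t (by simp at ht; omega)]]
    exact .step (ih fun t ht => hx t (by omega)) hc hp

/-- A series of least cost among all series that can be aligned is a mean. -/
theorem isMean_of_reach {k : ℕ} {x : Fin k → TimeSeries} {w : Fin k → ℚ} (hw : ∀ j, 0 ≤ w j)
    {w' : ℕ → ℚ} {X : ℕ → ℕ → ℚ} {p : ℕ → ℕ} (hw' : ∀ j : Fin k, w' j = w j)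
    (hX : ∀ (j : Fin k) i, i < (x j).length → X j i = (x j).entry i)
    (hp : ∀ j : Fin k, p j = (x j).length - 1) {z : TimeSeries} {v : ℚ}
    (hz : Reach k w' X z.entry (z.length - 1) p v)
    (hv : ∀ y i u, Reach k w' X y i p u → v ≤ u) : IsMean x w z := by
  intro y
  have hX' : ∀ (j : Fin k) t, t ≤ p j → X j t = (x j).entry t := fun j t ht =>
    hX j t (by have := (x j).length_pos; have := hp j; omega)
  choose u hu hdu using fun j => exists_align_eq_dtw_sq y (x j)
  obtain ⟨u', hu', rfl⟩ := hz
  have h1 : frechet x w z ≤ ((∑ j ∈ Finset.range k, w' j * u' j : ℚ) : ℝ) := by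
    rw [Finset.sum_range]
    push_cast
    refine Finset.sum_le_sum fun j _ => ?_
    rw [hw' j]
    refine mul_le_mul_of_nonneg_left (dtw_sq_le ?_) (by exact_mod_cast hw j)
    have := (hu' j j.2).congr_right (hX' j)
    rwa [hp j] at this
  have h2 : frechet x w y = ((∑ j ∈ Finset.range k, w' j * (fun j => if h : j < k then u ⟨j, h⟩ else 0) j : ℚ) : ℝ) := by
    rw [Finset.sum_range]
    push_cast
    refine Finset.sum_congr rfl fun j _ => ?_
    rw [hw' j, hdu j]
    simp
  rw [h2]
  refine h1.trans ?_
  refine Rat.cast_le.2 (hv y.entry (y.length - 1) _ ⟨_, fun j hj => ?_, rfl⟩)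
  simp only [hj, dite_true]
  have := hu ⟨j, hj⟩
  rw [← hp ⟨j, hj⟩] at this
  exact this.congr_right fun t ht => (hX' ⟨j, hj⟩ t ht).symm

/-! ### The program

Arrays of natural numbers: `0` number of series, `1` lengths, `2` length of the output,
`3` offsets of the series, `4` digits of the states, `5` digits of the steps,
`6` and `7` indices of last entries and preceding states, `8` base, `9` number of states,
`10` number of steps, `11` final state, `12` state, `13` preceding state, `14` step, `15` series,
`16` position, `17` flag, `18` and `19` remainder and quotient, `20` current state of the output.

Arrays of rational numbers: `0` weights, `1` entries, `2` output, `3` optimal values,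
`4` last entries, `5`, `6` and `7` sums over segments. -/

/-- Set a scalar variable. -/
abbrev nset (a : ℕ) (e : NExp) : Program := .setNat a (.const 0) e

/-- Set a rational scalar variable. -/
abbrev qset (a : ℕ) (e : QExp) : Program := .setRat a (.const 0) e

/-- Tabulate the digits in base `b` of the numbers less than `N` in the array `a`. -/
def digitsProg (b N : NExp) (a : ℕ) : Program :=
  .seq (.seq (nset 18 (.const 0)) (nset 19 (.const 0)))
    (forLoop 12 N
      (.seq (.setNat a (.mul (nvar 12) (nvar 0)) (nvar 18))
        (.seq
          (forLoop 15 (.sub (nvar 0) (.const 1))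
            (.setNat a (.add (.mul (nvar 12) (nvar 0)) (.add (nvar 15) (.const 1)))
              (.get a (.add (.mul (nvar 19) (nvar 0)) (nvar 15)))))
          (.seq (nset 18 (.add (nvar 18) (.const 1)))
            (.ite (.natLt (nvar 18) b) .skip
              (.seq (nset 18 (.const 0)) (nset 19 (.add (nvar 19) (.const 1)))))))))

/-- The entries of `A` before position `m` are digits in base `b`, `k` for each number. -/
def DigitsUpTo (b k : ℕ) (A : ℕ → ℕ) (m : ℕ) : Prop :=
  ∀ Q j, j < k → Q * k + j < m → A (Q * k + j) = digit b Q j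

theorem mul_add_inj {k P Q i j : ℕ} (hi : i < k) (hj : j < k) (h : P * k + i = Q * k + j) :
    P = Q ∧ i = j := by
  have hk : 0 < k := by omega
  have h1 : (P * k + i) / k = (Q * k + j) / k := by rw [h]
  rw [Nat.mul_comm P, Nat.mul_comm Q, Nat.mul_add_div hk, Nat.mul_add_div hk,
    Nat.div_eq_of_lt hi, Nat.div_eq_of_lt hj] at h1
  have : P = Q := by simpa using h1
  subst this
  exact ⟨rfl, by omega⟩

theorem DigitsUpTo.update {b k P j v : ℕ} {A : ℕ → ℕ} (h : DigitsUpTo b k A (P * k + j))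
    (hj : j < k) (hv : v = digit b P j) :
    DigitsUpTo b k (Function.update A (P * k + j) v) (P * k + j + 1) := by
  intro Q i hi hlt
  by_cases he : Q * k + i = P * k + j
  · obtain ⟨rfl, rfl⟩ := mul_add_inj hi hj he
    simp [hv]
  · rw [Function.update_of_ne he]
    exact h Q i hi (by omega)

/-- Rows are filled in increasing order without division: scalars `18` and `19` carry the remainder
and quotient of the row number. Digit `0` is the remainder, and the other digits are copied from the
row of the quotient. -/
theorem runs_digitsProg {b N : NExp} {a : ℕ} {s : Mem} {k B M : ℕ} (ha : a ∉ [0, 12, 15, 18, 19])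
    (hk : s.nat 0 0 = k) (hk0 : 0 < k) (hB : 0 < B)
    (hb : ∀ s', Agree [12, a, 15, 18, 19] [] s s' → b.eval s' = B)
    (hN : ∀ s', Agree [12, a, 15, 18, 19] [] s s' → N.eval s' = M) :
    Runs (digitsProg b N a) s (M * (k * 40 + b.cost + N.cost + 60) + N.cost + 20)
      fun s' => ∀ P < M, ∀ j < k, s'.nat a (P * k + j) = digit B P j := by
  simp only [List.mem_cons, not_or, List.not_mem_nil, not_false_eq_true, and_true] at ha
  obtain ⟨a0, a1, a2, a3, a4⟩ := ha
  refine Runs.mono (Runs.seq (Runs.mono (runs_of_wp (R := fun s' => s'.nat 18 0 = 0 ∧ s'.nat 19 0 = 0)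
    ?_) le_rfl fun s₁ hA₁ h₁ => runs_forLoop (N := M) (T := k * 40 + b.cost + 50)
    (fun P s' => s'.nat 18 0 = P % B ∧ s'.nat 19 0 = P / B ∧
      DigitsUpTo B k (s'.nat a) (P * k)) ?_ ?_ ?_ ?_)) ?_ ?_
  · simp [Program.wp, NExp.eval, setNat_nat_self, setNat_nat_of_ne]
  · simp [Program.natWrites, forLoop, Ne.symm a1]
  · intro s' hA
    refine hN s' ((hA₁.mono ?_ ?_).trans (hA.mono ?_ ?_)) <;>
      simp [Program.natWrites, Program.ratWrites, forLoop]
  · refine ⟨by simp [setNat_nat_of_ne, h₁.1], by simp [setNat_nat_of_ne, h₁.2], ?_⟩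
    intro Q j _ h; omega
  · intro P s₂ hP hA₂ hP₂ ⟨hr, hq, hd⟩
    have hk₂ : s₂.nat 0 0 = k := by
      rw [hA₂.nat 0 (by simp [Program.natWrites, forLoop, Ne.symm a0]),
        hA₁.nat 0 (by simp [Program.natWrites]), hk]
    refine Runs.mono (Runs.seq (Runs.mono (runs_of_wp (R := fun s' =>
      DigitsUpTo B k (s'.nat a) (P * k + 0 + 1)) ?_) le_rfl fun s₃ hA₃ h₃ =>
      Runs.seq (Runs.mono (runs_forLoop (N := k - 1) (T := 21) (fun j s' =>
        DigitsUpTo B k (s'.nat a) (P * k + j + 1)) ?_ ?_ ?_ ?_) le_rfl fun s₄ hA₄ h₄ =>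
        runs_of_wp ?_))) ?_ fun s' _ h => h
    · simp only [Program.wp, NExp.eval, hk₂, hP₂, hr, setNat_nat_self]
      exact DigitsUpTo.update (by simpa using hd) hk0 (digit_zero ..).symm
    · simp [Program.natWrites, Ne.symm a2]
    · intro s' hA
      simp only [NExp.eval]
      rw [hA.nat 0 (by simp [Program.natWrites, Ne.symm a0]),
        hA₃.nat 0 (by simp [Program.natWrites, Ne.symm a0]), hk₂]
    · rwa [setNat_nat_of_ne _ _ _ a2]
    · intro j s₄ hj hA₄ hj₄ h₄
      refine (runs_of_wp ?_).mono (by simp [Program.bound, NExp.cost]) fun _ _ h => h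
      have e : ∀ c, c ≠ a → c ≠ 15 → s₄.nat c = s₂.nat c := fun c h1 h2 => by
        rw [hA₄.nat c (by simp [Program.natWrites, h1, h2]),
          hA₃.nat c (by simp [Program.natWrites, h1])]
      simp only [Program.wp, NExp.eval, setNat_nat_of_ne _ _ _ a2, setNat_nat_self, e 0 (Ne.symm a0)
        (by simp), e 12 (Ne.symm a1) (by simp), e 19 (Ne.symm a4) (by simp), hk₂, hP₂, hq, hj₄]
      refine DigitsUpTo.update h₄ (by omega) ?_
      rw [digit_succ]
      -- The cell to be copied is already filled, as `P / B ≤ P`. For `B = 1` it lies in the current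
      -- row itself, one place behind the writing position.
      refine h₄ _ _ (by omega) ?_
      have := Nat.mul_le_mul_right k (Nat.div_le_self P B)
      omega
    · have e : ∀ c, c ≠ a → c ≠ 15 → s₄.nat c = s₂.nat c := fun c h1 h2 => by
        rw [hA₄.nat c (by simp [Program.natWrites, forLoop, h1, h2]),
          hA₃.nat c (by simp [Program.natWrites, h1])]
      have hb₄ : ∀ x, b.eval (s₄.setNat 18 0 x) = B := fun x => by
        refine hb _ ((hA₁.mono ?_ ?_).trans ((hA₂.mono ?_ ?_).trans ((hA₃.mono ?_ ?_).trans
          ((hA₄.mono ?_ ?_).trans ((agree_setNat s₄ 18 0 x []).mono ?_ ?_))))) <;>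
        simp [Program.natWrites, Program.ratWrites, forLoop]
      have hd' : DigitsUpTo B k (s₄.nat a) ((P + 1) * k) := by
        convert h₄ using 1
        rw [Nat.succ_mul]; omega
      simp only [Program.wp, NExp.eval, Test.holds, setNat_nat_self, Function.update_self, hb₄,
        e 18 (Ne.symm a3) (by simp), hr, setNat_nat_of_ne _ _ _ a1, setNat_nat_of_ne _ _ _ a3,
        setNat_nat_of_ne _ _ _ a4, hd', and_true]
      -- From `P` to `P + 1` a carry occurs exactly when the increased remainder reaches `B`.
      have hdm := Nat.div_add_mod P B
      have hml := Nat.mod_lt P hB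
      constructor
      · intro hlt
        simp [setNat_nat_of_ne, setNat_nat_self, e 19 (Ne.symm a4) (by simp), hq]
        have : P + 1 = (P % B + 1) + B * (P / B) := by omega
        rw [this, Nat.add_mul_mod_self_left, Nat.mod_eq_of_lt hlt, Nat.add_mul_div_left _ _ hB,
          Nat.div_eq_of_lt hlt]
        simp
      · intro hlt
        simp [setNat_nat_of_ne, setNat_nat_self, e 19 (Ne.symm a4) (by simp), hq]
        have hB' : P % B + 1 = B := by omega
        have : P + 1 = B + B * (P / B) := by omega
        rw [this, Nat.add_mul_mod_self_left, Nat.mod_self, Nat.add_mul_div_left _ _ hB,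
          Nat.div_self hB]
        simp [add_comm]
    · simp [Program.bound, NExp.cost, Test.cost]
      have : (k - 1) * 35 ≤ k * 35 := Nat.mul_le_mul_right _ (Nat.sub_le _ _)
      omega
  · simp [Program.bound, NExp.cost]
    have : M * (k * 40 + b.cost + 50 + N.cost + 9) ≤ M * (k * 40 + b.cost + N.cost + 60) :=
      Nat.mul_le_mul_left _ (by omega)
    omega
  · rintro s' - ⟨-, -, hd⟩ P hP j hj
    refine hd P j hj ?_
    have := Nat.mul_le_mul_right k (Nat.succ_le_of_lt hP)
    rw [Nat.succ_mul] at this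
    omega

/-! ### Computing the sums over segments -/

/-- The entry of series `15` at the position `lo` plus `16`. -/
abbrev curEntry (lo : NExp) : QExp := .get 1 (.add (.get 3 (nvar 15)) (.add lo (nvar 16)))

/-- The weight of series `15`. -/
abbrev curWeight : QExp := .get 0 (nvar 15)

/-- The digit of state `12` for series `15`. -/
abbrev curDigit : NExp := .get 4 (.add (.mul (nvar 12) (nvar 0)) (nvar 15))

/-- Sum up the segments from `lo` to the digits of state `12`, and record in the scalar `17`
whether all lower ends `lo` are at most the upper ends. -/
def segProg (lo : NExp) : Program :=
  .seq (.seq (nset 17 (.const 1))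
      (.seq (qset 5 (.const 0)) (.seq (qset 6 (.const 0)) (qset 7 (.const 0)))))
    (forLoop 15 (nvar 0)
      (.seq (.ite (.natLt curDigit lo) (nset 17 (.const 0)) .skip)
        (forLoop 16 (.sub (.add curDigit (.const 1)) lo)
          (.seq (qset 5 (.add (qvar 5) curWeight))
            (.seq (qset 6 (.add (qvar 6) (.mul curWeight (curEntry lo))))
              (qset 7 (.add (qvar 7) (.mul (.mul curWeight (curEntry lo)) (curEntry lo)))))))))

/-- The lower end may depend on the current series and must only be stable under the writes of this
program. The sums are correct even if some lower end exceeds the upper end; the flag tells these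
cases apart. -/
theorem runs_segProg {lo : NExp} {s : Mem} {k n P : ℕ} {p l : ℕ → ℕ} {w : ℕ → ℚ}
    {X : ℕ → ℕ → ℚ} (hk : s.nat 0 0 = k) (hP : s.nat 12 0 = P)
    (hp : ∀ j < k, s.nat 4 (P * k + j) = p j) (hpn : ∀ j < k, p j < n)
    (hw : ∀ j < k, s.rat 0 j = w j) (hX : ∀ j < k, ∀ i, s.rat 1 (s.nat 3 j + i) = X j i)
    (hlo : ∀ s', Agree [15, 16, 17] [5, 6, 7] s s' → ∀ j < k, s'.nat 15 0 = j →
      lo.eval s' = l j) (hc : lo.cost ≤ 20) :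
    Runs (segProg lo) s (k * (n * 200 + 200) + 100) fun s' =>
      s'.rat 5 0 = segWeight k w l p ∧ s'.rat 6 0 = segSum k w X l p ∧
      s'.rat 7 0 = segSq k w X l p ∧ (0 < s'.nat 17 0 ↔ ∀ j < k, l j ≤ p j) := by
  refine Runs.mono (Runs.seq (Runs.mono (runs_of_wp (R := fun s' => s'.nat 17 0 = 1 ∧
    s'.rat 5 0 = 0 ∧ s'.rat 6 0 = 0 ∧ s'.rat 7 0 = 0) ?_) le_rfl fun s₁ hA₁ h₁ =>
    runs_forLoop (N := k) (T := n * 200 + 150)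
    (fun m s' => s'.rat 5 0 = segWeight m w l p ∧ s'.rat 6 0 = segSum m w X l p ∧
      s'.rat 7 0 = segSq m w X l p ∧ (0 < s'.nat 17 0 ↔ ∀ j < m, l j ≤ p j)) ?_ ?_ ?_ ?_)) ?_
    fun s' _ h => h
  · simp [Program.wp, NExp.eval, QExp.eval, setNat_nat_self, setRat_rat_self, setRat_rat_of_ne]
  · simp [Program.natWrites, forLoop]
  · intro s' hA
    simp only [NExp.eval]
    rw [hA.nat 0 (by simp [Program.natWrites, forLoop]), hA₁.nat 0 (by simp [Program.natWrites]),
      hk]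
  · simp [setNat_nat_of_ne, h₁, segWeight, segSum, segSq]
  · intro j s₂ hj hA₂ hj₂ ⟨h5, h6, h7, h17⟩
    have hA : Agree [15, 16, 17] [5, 6, 7] s s₂ := by
      refine (hA₁.mono ?_ ?_).trans (hA₂.mono ?_ ?_) <;>
        simp [Program.natWrites, Program.ratWrites, forLoop]
    have ctx : ∀ s', Agree [16, 17] [5, 6, 7] s₂ s' → s'.nat 15 0 = j ∧ lo.eval s' = l j ∧
        curDigit.eval s' = p j ∧ s'.rat 0 j = w j ∧
        ∀ i, s'.rat 1 (s'.nat 3 j + i) = X j i := by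
      intro s' h'
      have h'' := hA.trans (h'.mono (by simp) (by simp))
      have e : s'.nat 15 0 = j := by rw [h'.nat 15 (by simp), hj₂]
      refine ⟨e, hlo s' h'' j hj e, ?_, ?_, fun i => ?_⟩
      · simp only [NExp.eval, e]
        rw [h''.nat 12 (by simp), h''.nat 0 (by simp), h''.nat 4 (by simp), hk, hP, hp j hj]
      · rw [h''.rat 0 (by simp), hw j hj]
      · rw [h''.rat 1 (by simp), h''.nat 3 (by simp), hX j hj]
    refine Runs.mono (Runs.seq (Runs.mono (runs_of_wp (R := fun s' =>
      (0 < s'.nat 17 0 ↔ ∀ i < j + 1, l i ≤ p i) ∧ s'.rat 5 0 = segWeight j w l p ∧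
      s'.rat 6 0 = segSum j w X l p ∧ s'.rat 7 0 = segSq j w X l p) ?_) le_rfl
      -- Truncated subtraction gives no rounds when `l j > p j`, matching the empty `Ico`.
      fun s₃ hA₃ ⟨h17', h5', h6', h7'⟩ => runs_forLoop (N := p j + 1 - l j)
      (T := 130) (fun i s' => s'.rat 5 0 = segWeight j w l p + ∑ _t ∈ Finset.range i, w j ∧
        s'.rat 6 0 = segSum j w X l p + ∑ t ∈ Finset.range i, w j * X j (l j + t) ∧
        s'.rat 7 0 = segSq j w X l p +
          ∑ t ∈ Finset.range i, w j * X j (l j + t) * X j (l j + t) ∧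
        (0 < s'.nat 17 0 ↔ ∀ i < j + 1, l i ≤ p i)) ?_ ?_ ?_ ?_)) ?_ ?_
    · obtain ⟨-, e1, e2, -, -⟩ := ctx s₂ (Agree.refl _ _ _)
      simp only [Program.wp, Test.holds, e1, e2]
      refine ⟨fun hlt => ⟨?_, h5, h6, h7⟩, fun hlt => ⟨?_, h5, h6, h7⟩⟩
      · simp only [setNat_nat_self, NExp.eval, Function.update_self, lt_irrefl, false_iff]
        exact fun h => absurd (h j (Nat.lt_succ_self j)) (not_le.2 hlt)
      · rw [h17]
        refine ⟨fun h i hi => ?_, fun h i hi => h i (by omega)⟩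
        rcases Nat.lt_succ_iff_lt_or_eq.1 hi with hi | rfl
        · exact h i hi
        · exact not_lt.1 hlt
    · simp [Program.natWrites]
    · intro s' h'
      obtain ⟨-, e1, e2, -, -⟩ := ctx s' (by
        refine (hA₃.mono ?_ ?_).trans (h'.mono ?_ ?_) <;>
          simp [Program.natWrites, Program.ratWrites])
      have e : ∀ f : NExp, (NExp.sub (.add f (.const 1)) lo).eval s' =
        f.eval s' + 1 - lo.eval s' := fun _ => rfl
      rw [e, e1, e2]
    · simp [h5', h6', h7', h17', setNat_nat_of_ne]
    · intro i s₄ hi h₄ hi₄ ⟨f5, f6, f7, f17⟩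
      have hA₄ : Agree [16, 17] [5, 6, 7] s₂ s₄ := by
        refine (hA₃.mono ?_ ?_).trans (h₄.mono ?_ ?_) <;>
          simp [Program.natWrites, Program.ratWrites]
      have hx : ∀ s', Agree [] [5, 6, 7] s₄ s' → (curEntry lo).eval s' = X j (l j + i) := by
        intro s' h'
        obtain ⟨e0, e1, -, -, e4⟩ := ctx s' (hA₄.trans (h'.mono (by simp) (by simp)))
        simp only [QExp.eval, NExp.eval, e0, e1, h'.nat 16 (by simp), hi₄, e4]
      have hw' : ∀ s', Agree [] [5, 6, 7] s₄ s' → curWeight.eval s' = w j := by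
        intro s' h'
        obtain ⟨e0, -, -, e3, -⟩ := ctx s' (hA₄.trans (h'.mono (by simp) (by simp)))
        simp only [QExp.eval, NExp.eval, e0, e3]
      have hset : ∀ (s' : Mem) a v, a ∈ [5, 6, 7] → Agree [] [5, 6, 7] s' (s'.setRat a 0 v) :=
        fun s' a v ha => ⟨fun _ _ => rfl, fun b hb => setRat_rat_of_ne _ _ _ fun h => hb (h ▸ ha)⟩
      have q0 := Agree.refl [] [5, 6, 7] s₄
      have q1 := fun v => hset s₄ 5 v (by simp)
      have q2 := fun v v' => (q1 v).trans (hset (s₄.setRat 5 0 v) 6 v' (by simp))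
      refine (runs_of_wp ?_).mono ?_ fun _ _ h => h
      -- Only these evaluations are unfolded, so that `hx` and `hw'` can rewrite the values of
      -- `curEntry lo` and `curWeight` as a whole.
      · have ev : ∀ (s' : Mem) (e f : QExp), (QExp.add e f).eval s' = e.eval s' + f.eval s' :=
          fun _ _ _ => rfl
        have ev' : ∀ (s' : Mem) (e f : QExp), (QExp.mul e f).eval s' = e.eval s' * f.eval s' :=
          fun _ _ _ => rfl
        have ev0 : ∀ (s' : Mem) a, (qvar a).eval s' = s'.rat a 0 := fun _ _ => rfl
        have evc : ∀ s', (NExp.const 0).eval s' = 0 := fun _ => rfl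
        simp only [Program.wp, evc, ev, ev', ev0, hw' _ q0, hw' _ (q1 _), hw' _ (q2 _ _),
          hx _ (q1 _), hx _ (q2 _ _)]
        simp [setRat_rat_of_ne, setRat_rat_self, setNat_nat_of_ne, f5, f6, f7, f17, Finset.sum_range_succ, add_assoc,
          add_mul]
      · simp only [Program.bound, NExp.cost, QExp.cost]; omega
    · simp only [Program.bound, NExp.cost, Test.cost]
      have h1 : p j + 1 - l j ≤ n := by have := hpn j hj; omega
      have h2 : (p j + 1 - l j) * (130 + (1 + 1 + (1 + 1) + 1 + (1 + 1) + 1 + 1 + 1 + 1 + lo.cost + 1) + 9)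
        ≤ n * 200 := Nat.mul_le_mul h1 (by omega)
      omega
    · rintro s' hA' ⟨g5, g6, g7, g17⟩
      have e : ∀ f : ℕ → ℚ, ∑ t ∈ Finset.range (p j + 1 - l j), f (l j + t) =
        ∑ t ∈ Finset.Ico (l j) (p j + 1), f t := fun f => (Finset.sum_Ico_eq_sum_range ..).symm
      rw [e fun t => w j * X j t] at g6
      rw [e fun t => w j * X j t * X j t] at g7
      rw [e fun _ => w j] at g5
      refine ⟨?_, ?_, ?_, ?_⟩
      · rw [setNat_rat, g5, segWeight, segWeight, Finset.sum_range_succ]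
      · rw [setNat_rat, g6, segSum, segSum, Finset.sum_range_succ]
      · rw [setNat_rat, g7, segSq, segSq, Finset.sum_range_succ]
      · rw [setNat_nat_of_ne _ _ _ (by simp), g17]
  · simp only [Program.bound, NExp.cost, QExp.cost]
    have : k * (n * 200 + 150 + (1 + 1) + 9) ≤ k * (n * 200 + 200) :=
      Nat.mul_le_mul_left _ (by omega)
    omega

/-! ### Filling the tables -/

/-- The lower end, for series `15`, of the segment after state `13` with step `14`. -/
def nextLow : NExp :=
  .add (.get 4 (.add (.mul (nvar 13) (nvar 0)) (nvar 15)))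
    (.get 5 (.add (.mul (nvar 14) (nvar 0)) (nvar 15)))

/-- The least cost of one entry, from the sums over segments. -/
def segMinExp : QExp := .sub (qvar 7) (.div (.mul (qvar 6) (qvar 6)) (qvar 5))

/-- The optimal entry, from the sums over segments. -/
def segMeanExp : QExp := .div (qvar 6) (qvar 5)

/-- Write the tables at state `12`. -/
def recordProg (v : QExp) (l q : NExp) : Program :=
  .seq (.setRat 3 (nvar 12) v)
    (.seq (.setRat 4 (nvar 12) segMeanExp)
      (.seq (.setNat 6 (nvar 12) l) (.setNat 7 (nvar 12) q)))

/-- The value of state `12` by way of state `13`. -/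
def viaExp : QExp := .add (.get 3 (nvar 13)) segMinExp

/-- Improve state `12` by way of state `13` and step `14`, if possible. -/
def stepProg : Program :=
  .seq (segProg nextLow)
    (.ite (.and (.natLt (.const 0) (nvar 17)) (.ratLt viaExp (.get 3 (nvar 12))))
      (recordProg viaExp (.add (.get 6 (nvar 13)) (.const 1)) (nvar 13)) .skip)

/-- Compute the tables for state `12`. -/
def stateProg : Program :=
  .seq (.seq (segProg (.const 0)) (recordProg segMinExp (.const 0) (.const 0)))
    (forLoop 13 (nvar 12) (forLoop 14 (nvar 10) stepProg))

/-- Compute the tables for all states. -/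
def tableProg : Program := forLoop 12 (nvar 9) stateProg

/-- The tables in a memory. -/
def Mem.tables (s : Mem) : Tables := ⟨s.rat 3, s.rat 4, s.nat 6, s.nat 7⟩

theorem Agree.tables {A B : List ℕ} {s s' : Mem} (h : Agree A B s s') (h3 : 3 ∉ B) (h4 : 4 ∉ B)
    (h6 : 6 ∉ A) (h7 : 7 ∉ A) : s'.tables = s.tables := by
  simp only [Mem.tables, h.nat _ h6, h.nat _ h7, h.rat _ h3, h.rat _ h4]

/-- The memory holds the precomputed data. -/
structure Env (k n : ℕ) (w : ℕ → ℚ) (X : ℕ → ℕ → ℚ) (s : Mem) : Prop where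
  num : s.nat 0 0 = k
  dig : ∀ P < n ^ k, ∀ j < k, s.nat 4 (P * k + j) = digit n P j
  bit : ∀ c < 2 ^ k, ∀ j < k, s.nat 5 (c * k + j) = digit 2 c j
  states : s.nat 9 0 = n ^ k
  steps : s.nat 10 0 = 2 ^ k
  weight : ∀ j < k, s.rat 0 j = w j
  entry : ∀ j < k, ∀ i, s.rat 1 (s.nat 3 j + i) = X j i

variable {k n : ℕ} {w : ℕ → ℚ} {X : ℕ → ℕ → ℚ}

theorem Env.of_agree {A B : List ℕ} {s s' : Mem} (h : Env k n w X s) (hA : Agree A B s s')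
    (h0 : ∀ a ∈ [0, 3, 4, 5, 9, 10], a ∉ A) (h1 : ∀ a ∈ [0, 1], a ∉ B) : Env k n w X s' := by
  have e : ∀ a ∈ [0, 3, 4, 5, 9, 10], s'.nat a = s.nat a := fun a ha => hA.nat a (h0 a ha)
  have f : ∀ a ∈ [0, 1], s'.rat a = s.rat a := fun a ha => hA.rat a (h1 a ha)
  refine ⟨?_, ?_, ?_, ?_, ?_, ?_, ?_⟩
  · rw [e 0 (by simp)]; exact h.num
  · rw [e 4 (by simp)]; exact h.dig
  · rw [e 5 (by simp)]; exact h.bit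
  · rw [e 9 (by simp)]; exact h.states
  · rw [e 10 (by simp)]; exact h.steps
  · rw [f 0 (by simp)]; exact h.weight
  · rw [f 1 (by simp), e 3 (by simp)]; exact h.entry

theorem segMinExp_eval {s : Mem} {a b : ℕ → ℕ} (h5 : s.rat 5 0 = segWeight k w a b)
    (h6 : s.rat 6 0 = segSum k w X a b) (h7 : s.rat 7 0 = segSq k w X a b) :
    segMinExp.eval s = segMin k w X a b := by
  simp [segMinExp, QExp.eval, NExp.eval, h5, h6, h7, segMin]

/-- The four writes are sequential, so `l` and `q` are evaluated after some of them; `hl` and `hq`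
ensure that this does not affect their values. -/
theorem wp_recordProg {v : QExp} {l q : NExp} {s : Mem} {R : Mem → Prop} {P : ℕ} {a b : ℕ → ℕ}
    (hP : s.nat 12 0 = P) (h5 : s.rat 5 0 = segWeight k w a b)
    (h6 : s.rat 6 0 = segSum k w X a b)
    (hl : ∀ s', Agree [] [3, 4] s s' → l.eval s' = l.eval s)
    (hq : ∀ s', Agree [6] [3, 4] s s' → q.eval s' = q.eval s)
    (hR : ∀ s', s'.tables = s.tables.set P (v.eval s) (segMean k w X a b) (l.eval s) (q.eval s) →
      R s') : (recordProg v l q).wp R s := by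
  simp only [recordProg, Program.wp]
  apply hR
  have ag : ∀ x y, Agree [] [3, 4] s ((s.setRat 3 P x).setRat 4 P y) := fun x y =>
    ⟨fun _ _ => rfl, fun b hb => by
      simp only [List.mem_cons, not_or] at hb
      rw [setRat_rat_of_ne _ _ _ hb.2.1, setRat_rat_of_ne _ _ _ hb.1]⟩
  have ag' : ∀ x y z, Agree [6] [3, 4] s (((s.setRat 3 P x).setRat 4 P y).setNat 6 P z) :=
    fun x y z => ((ag x y).mono (by simp) (by simp)).trans
      ((agree_setNat _ 6 P z [3, 4]).mono (by simp) (by simp))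
  have e : ∀ s', (nvar 12).eval s' = s'.nat 12 0 := fun _ => rfl
  have m : ∀ x, segMeanExp.eval (s.setRat 3 P x) = segMean k w X a b := fun x => by
    simp [segMeanExp, QExp.eval, NExp.eval, h5, h6, segMean, setRat_rat_of_ne]
  simp only [e, setRat_nat, setNat_nat_of_ne _ _ _ (show 12 ≠ 6 by simp), hP, m, hl _ (ag _ _),
    hq _ (ag' _ _ _)]
  simp [Mem.tables, Tables.set, setNat_nat_self, setNat_nat_of_ne, setRat_rat_self,
    setRat_rat_of_ne]

theorem good_set {t : Tables} {P : ℕ} (h : ∀ Q < P, Good k n w X t Q) (v m : ℚ) (l q : ℕ) :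
    ∀ Q < P, Good k n w X (t.set P v m l q) Q :=
  fun Q hQ => (h Q hQ).congr (t.agreeOn_set hQ v m l q)

/-- Whatever the outcome of the test, the pair `(Q, c)` is settled afterwards: an improvement is
recorded (`set_step`), or there was none to record (`skip_step`). -/
theorem runs_stepProg {s : Mem} {P Q c : ℕ} {D : ℕ → ℕ → Prop} (hn : 0 < n) (h : Env k n w X s)
    (hP : s.nat 12 0 = P) (hPn : P < n ^ k) (hQ : s.nat 13 0 = Q) (hQP : Q < P)
    (hc : s.nat 14 0 = c) (hck : c < 2 ^ k) (hg : ∀ Q' < P, Good k n w X s.tables Q')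
    (hp : Partial k n w X s.tables P D) :
    Runs stepProg s (k * (n * 200 + 200) + 250) fun s' =>
      (∀ Q' < P, Good k n w X s'.tables Q') ∧
      Partial k n w X s'.tables P fun Q' c' => D Q' c' ∨ (Q' = Q ∧ c' = c) := by
  refine Runs.mono (Runs.seq (Runs.mono (runs_segProg (n := n) (l := fun j => digit n Q j + digit 2 c j)
    h.num hP (h.dig P hPn) (fun j _ => digit_lt hn P j) h.weight h.entry ?_ ?_) le_rfl
    fun s₁ hA ⟨h5, h6, h7, h17⟩ => runs_of_wp ?_)) ?_ fun _ _ h => h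
  · intro s' hA j hj hj'
    simp only [nextLow, NExp.eval]
    rw [hA.nat 13 (by simp), hA.nat 14 (by simp), hA.nat 0 (by simp), hj', hA.nat 4 (by simp),
      hA.nat 5 (by simp), hQ, hc, h.num, h.dig Q (by omega) j hj, h.bit c hck j hj]
  · simp [nextLow, NExp.cost]
  · have ht : s₁.tables = s.tables := by
      refine hA.tables ?_ ?_ ?_ ?_ <;>
        simp [segProg, forLoop, Program.natWrites, Program.ratWrites]
    have e12 : s₁.nat 12 0 = P := by
      rw [hA.nat 12 (by simp [segProg, forLoop, Program.natWrites]), hP]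
    have e13 : s₁.nat 13 0 = Q := by
      rw [hA.nat 13 (by simp [segProg, forLoop, Program.natWrites]), hQ]
    have ev : viaExp.eval s₁ = s.tables.opt Q + stepMin k n w X P Q c := by
      have : viaExp.eval s₁ = s₁.tables.opt (s₁.nat 13 0) + segMinExp.eval s₁ := rfl
      rw [this, segMinExp_eval h5 h6 h7, ht, e13, stepMin]
    have eP : (QExp.get 3 (nvar 12)).eval s₁ = s.tables.opt P := by
      have : (QExp.get 3 (nvar 12)).eval s₁ = s₁.tables.opt (s₁.nat 12 0) := rfl
      rw [this, ht, e12]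
    have el : (NExp.add (.get 6 (nvar 13)) (.const 1)).eval s₁ = s.tables.index Q + 1 := by
      have : (NExp.add (.get 6 (nvar 13)) (.const 1)).eval s₁ =
        s₁.tables.index (s₁.nat 13 0) + 1 := rfl
      rw [this, ht, e13]
    have hadm : (Test.natLt (.const 0) (nvar 17)).holds s₁ ↔ Admissible k n P Q c := h17
    refine ⟨fun ⟨ha, hlt⟩ => ?_, fun hne => ?_⟩
    · refine wp_recordProg e12 h5 h6 ?_ ?_ fun s' hs' => ?_
      · intro s' h'
        simp only [NExp.eval]
        rw [h'.nat 13 (by simp), h'.nat 6 (by simp)]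
      · intro s' h'
        simp only [NExp.eval]
        rw [h'.nat 13 (by simp)]
      · rw [hs', ht, ev, el, show (nvar 13).eval s₁ = Q from e13]
        exact ⟨good_set hg _ _ _ _, hp.set_step hQP hck (hadm.1 ha)
          (by rw [Test.holds, ev, eP] at hlt; exact hlt)⟩
    · simp only [Program.wp, ht]
      refine ⟨hg, hp.skip_step fun ha hlt => hne ⟨hadm.2 ha, ?_⟩⟩
      rw [Test.holds, ev, eP]
      exact hlt
  · simp only [Program.bound, Test.cost, NExp.cost, QExp.cost, recordProg, viaExp, segMinExp,
      segMeanExp]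
    omega

/-- The invariant of the two nested loops is optimality over the start and all pairs
lexicographically before the current `(Q, c)`. Running over `Q < P` suffices because `Good` asks for
nothing else. -/
theorem runs_stateProg {s : Mem} {P : ℕ} (hn : 0 < n) (h : Env k n w X s)
    (hP : s.nat 12 0 = P) (hPn : P < n ^ k) (hg : ∀ Q < P, Good k n w X s.tables Q) :
    Runs stateProg s (n ^ k * (2 ^ k * (k * (n * 200 + 200) + 270) + 50) +
      k * (n * 200 + 200) + 300) fun s' => ∀ Q < P + 1, Good k n w X s'.tables Q := by
  refine Runs.mono (Runs.seq (Runs.mono (R := fun s' => (∀ Q < P, Good k n w X s'.tables Q) ∧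
    Partial k n w X s'.tables P fun Q _ => Q < 0) (T := k * (n * 200 + 200) + 200)
    (Runs.mono (Runs.seq (Runs.mono
    (runs_segProg (n := n) (l := fun _ => 0) h.num hP (h.dig P hPn) (fun j _ => digit_lt hn P j)
    h.weight h.entry (fun _ _ _ _ _ => rfl) (by simp [NExp.cost])) le_rfl
    fun s₁ hA ⟨h5, h6, h7, _⟩ => runs_of_wp ?_)) ?_ fun _ _ h => h) le_rfl
    fun s₂ hA₂ h₂ => runs_forLoop (N := P) (T := 2 ^ k * (k * (n * 200 + 200) + 270) + 10)
    (fun Q s' => (∀ Q < P, Good k n w X s'.tables Q) ∧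
      Partial k n w X s'.tables P fun Q' _ => Q' < Q) ?_ ?_ ?_ ?_)) ?_ ?_
  · have ht : s₁.tables = s.tables := by
      refine hA.tables ?_ ?_ ?_ ?_ <;>
        simp [segProg, forLoop, Program.natWrites, Program.ratWrites]
    have e12 : s₁.nat 12 0 = P := by
      rw [hA.nat 12 (by simp [segProg, forLoop, Program.natWrites]), hP]
    refine wp_recordProg e12 h5 h6 (fun _ _ => rfl) (fun _ _ => rfl) fun s' hs' => ?_
    rw [hs', ht, segMinExp_eval h5 h6 h7]
    refine ⟨good_set hg _ _ _ _, (partial_set_start ..).mono ?_⟩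
    intro Q c _ _ _ h
    exact absurd h (Nat.not_lt_zero _)
  · simp only [Program.bound, NExp.cost, QExp.cost, recordProg, segMinExp, segMeanExp]
    omega
  · simp [forLoop, stepProg, segProg, recordProg, Program.natWrites]
  · intro s' hA
    simp only [NExp.eval]
    rw [hA.nat 12 (by simp [forLoop, stepProg, segProg, recordProg, Program.natWrites]),
      hA₂.nat 12 (by simp [forLoop, segProg, recordProg, Program.natWrites]), hP]
  · rwa [(agree_setNat s₂ 13 0 0 []).tables (by simp) (by simp) (by simp) (by simp)]
  · intro Q s₃ hQP hA₃ hQ ⟨hg₃, hp₃⟩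
    have e₃ : Env k n w X s₃ := by
      refine (h.of_agree hA₂ ?_ ?_).of_agree hA₃ ?_ ?_ <;>
        simp [forLoop, stepProg, segProg, recordProg, Program.natWrites, Program.ratWrites]
    refine Runs.mono (runs_forLoop (N := 2 ^ k) (T := k * (n * 200 + 200) + 250)
      (fun c s' => (∀ Q < P, Good k n w X s'.tables Q) ∧
      Partial k n w X s'.tables P fun Q' c' => Q' < Q ∨ (Q' = Q ∧ c' < c)) ?_ ?_ ?_ ?_) ?_ ?_
    · simp [forLoop, stepProg, segProg, recordProg, Program.natWrites]
    · intro s' hA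
      simp only [NExp.eval]
      rw [hA.nat 10 (by simp [forLoop, stepProg, segProg, recordProg, Program.natWrites]),
        e₃.steps]
    · rw [(agree_setNat s₃ 14 0 0 []).tables (by simp) (by simp) (by simp) (by simp)]
      refine ⟨hg₃, hp₃.mono fun Q' c' _ _ _ h => ?_⟩
      simpa using h
    · intro c s₄ hc hA₄ hc₄ ⟨hg₄, hp₄⟩
      have e₄ : Env k n w X s₄ := by
        refine e₃.of_agree hA₄ ?_ ?_ <;>
        simp [forLoop, stepProg, segProg, recordProg, Program.natWrites, Program.ratWrites]
      refine (runs_stepProg hn e₄ (P := P) (Q := Q) ?_ hPn ?_ hQP hc₄ hc hg₄ hp₄).mono le_rfl ?_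
      · rw [hA₄.nat 12 (by simp [forLoop, stepProg, segProg, recordProg, Program.natWrites]),
          hA₃.nat 12 (by simp [forLoop, stepProg, segProg, recordProg, Program.natWrites]),
          hA₂.nat 12 (by simp [forLoop, segProg, recordProg, Program.natWrites]), hP]
      · rw [hA₄.nat 13 (by simp [forLoop, stepProg, segProg, recordProg, Program.natWrites]), hQ]
      · rintro s' - ⟨hg', hp'⟩
        rw [(agree_setNat s' 14 0 (c + 1) []).tables (by simp) (by simp) (by simp) (by simp)]
        refine ⟨hg', hp'.mono fun Q' c' _ _ _ h => ?_⟩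
        omega
    · simp only [NExp.cost]
      have : 2 ^ k * (k * (n * 200 + 200) + 250 + (1 + 1) + 9) ≤
        2 ^ k * (k * (n * 200 + 200) + 270) := Nat.mul_le_mul_left _ (by omega)
      linarith
    · rintro s' - ⟨hg', hp'⟩
      rw [(agree_setNat s' 13 0 (Q + 1) []).tables (by simp) (by simp) (by simp) (by simp)]
      refine ⟨hg', hp'.mono fun Q' c' _ _ _ h => ?_⟩
      omega
  · simp only [NExp.cost]
    have : P * (2 ^ k * (k * (n * 200 + 200) + 270) + 10 + (1 + 1) + 9) ≤
      n ^ k * (2 ^ k * (k * (n * 200 + 200) + 270) + 50) := Nat.mul_le_mul hPn.le (by omega)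
    omega
  · rintro s' - ⟨hg', hp'⟩ Q hQ
    rcases Nat.lt_succ_iff_lt_or_eq.1 hQ with hQ | rfl
    · exact hg' Q hQ
    · exact hp'.mono fun Q' _ hQ' _ _ _ => hQ'

theorem runs_tableProg {s : Mem} (hn : 0 < n) (h : Env k n w X s) :
    Runs tableProg s (n ^ k * (n ^ k * (2 ^ k * (k * (n * 200 + 200) + 270) + 50) +
      k * (n * 200 + 200) + 350) + 50) fun s' => ∀ Q < n ^ k, Good k n w X s'.tables Q := by
  refine Runs.mono (runs_forLoop (N := n ^ k) (T := n ^ k * (2 ^ k * (k * (n * 200 + 200) + 270) +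
    50) + k * (n * 200 + 200) + 300) (fun P s' => ∀ Q < P, Good k n w X s'.tables Q)
    ?_ ?_ ?_ ?_) ?_ fun _ _ h => h
  · simp [forLoop, stateProg, stepProg, segProg, recordProg, Program.natWrites]
  · intro s' hA
    simp only [NExp.eval]
    rw [hA.nat 9 (by simp [forLoop, stateProg, stepProg, segProg, recordProg, Program.natWrites]),
      h.states]
  · intro Q hQ; omega
  · intro P s₁ hP hA hP₁ hg
    have e₁ : Env k n w X s₁ := by
      refine h.of_agree hA ?_ ?_ <;> simp [forLoop, stateProg, stepProg, segProg, recordProg,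
        Program.natWrites, Program.ratWrites]
    refine (runs_stateProg hn e₁ hP₁ hP hg).mono le_rfl fun s' _ h' => ?_
    rwa [(agree_setNat s' 12 0 (P + 1) []).tables (by simp) (by simp) (by simp) (by simp)]
  · simp only [NExp.cost]
    have : n ^ k * (n ^ k * (2 ^ k * (k * (n * 200 + 200) + 270) + 50) + k * (n * 200 + 200) + 300
        + (1 + 1) + 9) ≤ n ^ k * (n ^ k * (2 ^ k * (k * (n * 200 + 200) + 270) + 50) +
      k * (n * 200 + 200) + 350) := Nat.mul_le_mul_left _ (by omega)
    linarith

/-! ### Preprocessing -/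

/-- Compute the base, the offsets, the numbers of states and steps, the final state, and the
tables of digits. -/
def prepProg : Program :=
  .seq (.seq (nset 8 (.const 0)) (nset 3 (.const 0)))
    (.seq
      (forLoop 15 (nvar 0)
        (.seq (.setNat 3 (.add (nvar 15) (.const 1)) (.add (.get 3 (nvar 15)) (.get 1 (nvar 15))))
          (.ite (.natLt (nvar 8) (.get 1 (nvar 15))) (nset 8 (.get 1 (nvar 15))) .skip)))
      (.seq (.seq (nset 9 (.const 1)) (.seq (nset 10 (.const 1)) (nset 11 (.const 0))))
        (.seq
          (forLoop 15 (nvar 0)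
            (.seq (nset 11 (.add (nvar 11)
                (.mul (.sub (.get 1 (nvar 15)) (.const 1)) (nvar 9))))
              (.seq (nset 9 (.mul (nvar 9) (nvar 8))) (nset 10 (.mul (nvar 10) (.const 2))))))
          (.seq (digitsProg (nvar 8) (nvar 9) 4) (digitsProg (.const 2) (nvar 10) 5)))))

/-- The position of the first entry of series `j`. -/
def offset (L : ℕ → ℕ) (j : ℕ) : ℕ := ∑ i ∈ Finset.range j, L i

theorem runs_prepProg {s : Mem} {k n : ℕ} {L : ℕ → ℕ} (hk : s.nat 0 0 = k) (hk0 : 0 < k)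
    (hL : s.nat 1 = L) (hn : (Finset.range k).sup L = n) (hn0 : 0 < n) :
    Runs prepProg s (n ^ k * (k * 40 + 80) + 2 ^ k * (k * 40 + 80) + k * 150 + 200) fun s' =>
      Env k n (s.rat 0) (fun j i => s.rat 1 (offset L j + i)) s' ∧
      s'.nat 11 0 = ofDigitFun n k fun j => L j - 1 := by
  refine Runs.mono (Runs.seq (T := 6) (T' := k * 130 + n ^ k * (k * 40 + 80) + 2 ^ k * (k * 40 + 80) + 150)
    (Runs.mono (runs_of_wp (R := fun s' => s'.nat 8 0 = 0 ∧ s'.nat 3 0 = 0) ?_)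
      (by simp [Program.bound, NExp.cost]) fun s₁ hA₁ ⟨h8, h3⟩ =>
    Runs.mono (Runs.seq (Runs.mono (runs_forLoop (N := k) (T := 30)
      (fun m s' => s'.nat 8 0 = (Finset.range m).sup L ∧ ∀ j ≤ m, s'.nat 3 j = offset L j)
      ?_ ?_ ?_ ?_) le_rfl fun s₂ hA₂ ⟨h8₂, h3₂⟩ =>
    Runs.seq (T := 9) (Runs.mono (runs_of_wp
      (R := fun s' => s'.nat 9 0 = 1 ∧ s'.nat 10 0 = 1 ∧ s'.nat 11 0 = 0) ?_)
      (by simp [Program.bound, NExp.cost]) fun s₃ hA₃ ⟨h9₃, h10₃, h11₃⟩ =>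
    Runs.seq (Runs.mono (runs_forLoop (N := k) (T := 40)
      -- Scalar `9` plays two roles: within the loop it is the place value of the next digit of the
      -- final state, at the end it is the number of states.
      (fun m s' => s'.nat 9 0 = n ^ m ∧ s'.nat 10 0 = 2 ^ m ∧
        s'.nat 11 0 = ofDigitFun n m fun j => L j - 1) ?_ ?_ ?_ ?_) le_rfl
      fun s₄ hA₄ ⟨h9₄, h10₄, h11₄⟩ =>
    Runs.seq (Runs.mono (runs_digitsProg (k := k) (B := n) (M := n ^ k) ?_ ?_ hk0 hn0 ?_ ?_) le_rfl
      fun s₅ hA₅ h₅ =>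
    Runs.mono (runs_digitsProg (k := k) (B := 2) (M := 2 ^ k) ?_ ?_ hk0 two_pos ?_ ?_) le_rfl
      fun s₆ hA₆ h₆ => ?_))))) ?_ fun _ _ h => h)) ?_ fun _ _ h => h
  · simp [Program.wp, NExp.eval, setNat_nat_self, setNat_nat_of_ne]
  · simp [Program.natWrites]
  · intro s' hA
    simp only [NExp.eval]
    rw [hA.nat 0 (by simp [Program.natWrites]), hA₁.nat 0 (by simp [Program.natWrites]), hk]
  · simp [setNat_nat_of_ne, h8, h3, offset]
  · intro j s' hj hA hj' ⟨g8, g3⟩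
    have g1 : s'.nat 1 = L := by
      rw [hA.nat 1 (by simp [Program.natWrites]), hA₁.nat 1 (by simp [Program.natWrites]), hL]
    refine (runs_of_wp ?_).mono (by simp [Program.bound, NExp.cost, Test.cost]) fun _ _ h => h
    have off : ∀ i ≤ j + 1, Function.update (s'.nat 3) (j + 1) (offset L j + L j) i =
        offset L i := by
      intro i hi
      rcases hi.eq_or_lt with rfl | hi
      · simp [offset, Finset.sum_range_succ]
      · rw [Function.update_of_ne hi.ne, g3 i (by omega)]
    simp only [Program.wp, Test.holds, NExp.eval, hj', g1, g3 j le_rfl, setNat_nat_self,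
      setNat_nat_of_ne _ _ _ (show 1 ≠ 3 by simp), setNat_nat_of_ne _ _ _ (show 8 ≠ 3 by simp),
      setNat_nat_of_ne _ _ _ (show 15 ≠ 3 by simp), setNat_nat_of_ne _ _ _ (show 3 ≠ 8 by simp),
      setNat_nat_of_ne _ _ _ (show 3 ≠ 15 by simp), setNat_nat_of_ne _ _ _ (show 8 ≠ 15 by simp),
      g8, Finset.range_add_one, Finset.sup_insert, Function.update_self]
    refine ⟨fun h => ⟨(sup_eq_left.2 h.le).symm, off⟩,
      fun h => ⟨(sup_eq_right.2 (not_lt.1 h)).symm, off⟩⟩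
  · simp [Program.wp, NExp.eval, setNat_nat_self, setNat_nat_of_ne]
  · simp [Program.natWrites]
  · intro s' hA
    simp only [NExp.eval]
    rw [hA.nat 0 (by simp [Program.natWrites]), hA₃.nat 0 (by simp [Program.natWrites]),
      hA₂.nat 0 (by simp [forLoop, Program.natWrites]), hA₁.nat 0 (by simp [Program.natWrites]), hk]
  · simp [setNat_nat_of_ne, h9₃, h10₃, h11₃, ofDigitFun]
  · intro j s' hj hA hj' ⟨g9, g10, g11⟩
    have g1 : s'.nat 1 = L := by
      rw [hA.nat 1 (by simp [Program.natWrites]), hA₃.nat 1 (by simp [Program.natWrites]),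
        hA₂.nat 1 (by simp [forLoop, Program.natWrites]), hA₁.nat 1 (by simp [Program.natWrites]),
        hL]
    have g8 : s'.nat 8 0 = n := by
      rw [hA.nat 8 (by simp [Program.natWrites]), hA₃.nat 8 (by simp [Program.natWrites]), h8₂, hn]
    refine (runs_of_wp ?_).mono (by simp [Program.bound, NExp.cost]) fun _ _ h => h
    simp [Program.wp, NExp.eval, setNat_nat_of_ne, setNat_nat_self, g8, g9, g10, g11, g1, hj',
      pow_succ, ofDigitFun, Finset.sum_range_succ]
  · simp
  · rw [hA₄.nat 0 (by simp [forLoop, Program.natWrites]), hA₃.nat 0 (by simp [Program.natWrites]),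
      hA₂.nat 0 (by simp [forLoop, Program.natWrites]), hA₁.nat 0 (by simp [Program.natWrites]), hk]
  · intro s' hA
    simp only [NExp.eval]
    rw [hA.nat 8 (by simp), hA₄.nat 8 (by simp [forLoop, Program.natWrites]),
      hA₃.nat 8 (by simp [Program.natWrites]), h8₂, hn]
  · intro s' hA
    simp only [NExp.eval]
    rw [hA.nat 9 (by simp), h9₄]
  · simp
  · rw [hA₅.nat 0 (by simp [digitsProg, forLoop, Program.natWrites]),
      hA₄.nat 0 (by simp [forLoop, Program.natWrites]), hA₃.nat 0 (by simp [Program.natWrites]),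
      hA₂.nat 0 (by simp [forLoop, Program.natWrites]), hA₁.nat 0 (by simp [Program.natWrites]), hk]
  · exact fun _ _ => rfl
  · intro s' hA
    simp only [NExp.eval]
    rw [hA.nat 10 (by simp), hA₅.nat 10 (by simp [digitsProg, forLoop, Program.natWrites]), h10₄]
  · have keep : ∀ a ∉ [4, 5, 8, 3, 9, 10, 11, 12, 15, 18, 19], s₆.nat a = s.nat a := by
      intro a ha
      simp only [List.mem_cons, not_or, List.not_mem_nil, not_false_eq_true, and_true] at ha
      rw [hA₆.nat a (by simp [digitsProg, forLoop, Program.natWrites, ha]),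
        hA₅.nat a (by simp [digitsProg, forLoop, Program.natWrites, ha]),
        hA₄.nat a (by simp [forLoop, Program.natWrites, ha]),
        hA₃.nat a (by simp [Program.natWrites, ha]),
        hA₂.nat a (by simp [forLoop, Program.natWrites, ha]),
        hA₁.nat a (by simp [Program.natWrites, ha])]
    have keepr : ∀ a, s₆.rat a = s.rat a := by
      intro a
      rw [hA₆.rat a (by simp [digitsProg, forLoop, Program.ratWrites]),
        hA₅.rat a (by simp [digitsProg, forLoop, Program.ratWrites]),
        hA₄.rat a (by simp [forLoop, Program.ratWrites]),
        hA₃.rat a (by simp [Program.ratWrites]),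
        hA₂.rat a (by simp [forLoop, Program.ratWrites]),
        hA₁.rat a (by simp [Program.ratWrites])]
    have keep4 : ∀ a ∈ [9, 10, 11], s₆.nat a = s₄.nat a := by
      intro a ha
      rw [hA₆.nat a (by simp at ha; simp [digitsProg, forLoop, Program.natWrites]; omega),
        hA₅.nat a (by simp at ha; simp [digitsProg, forLoop, Program.natWrites]; omega)]
    refine ⟨⟨?_, ?_, h₆, ?_, ?_, ?_, ?_⟩, ?_⟩
    · rw [keep 0 (by simp), hk]
    · rw [hA₆.nat 4 (by simp [digitsProg, forLoop, Program.natWrites])]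
      exact h₅
    · rw [keep4 9 (by simp), h9₄]
    · rw [keep4 10 (by simp), h10₄]
    · intro j _; rw [keepr]
    · intro j hj i
      rw [keepr, hA₆.nat 3 (by simp [digitsProg, forLoop, Program.natWrites]),
        hA₅.nat 3 (by simp [digitsProg, forLoop, Program.natWrites]),
        hA₄.nat 3 (by simp [forLoop, Program.natWrites]),
        hA₃.nat 3 (by simp [Program.natWrites]), h3₂ j hj.le]
    · rw [keep4 11 (by simp), h11₄]
  · simp only [NExp.cost]
    have h1 : n ^ k * (k * 40 + (1 + 1) + (1 + 1) + 60) ≤ n ^ k * (k * 40 + 80) :=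
      Nat.mul_le_mul_left _ (by omega)
    have h2 : 2 ^ k * (k * 40 + 1 + (1 + 1) + 60) ≤ 2 ^ k * (k * 40 + 80) :=
      Nat.mul_le_mul_left _ (by omega)
    linarith
  · linarith

/-! ### Writing the output -/

/-- Write the series that leads to state `11` to the output. -/
def outProg : Program :=
  .seq (.seq (nset 2 (.add (.get 6 (nvar 11)) (.const 1))) (nset 20 (nvar 11)))
    (forLoop 16 (nvar 2)
      (.seq (.setRat 2 (.sub (nvar 2) (.add (nvar 16) (.const 1))) (.get 4 (nvar 20)))
        (nset 20 (.get 7 (nvar 20)))))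

/-- Back pointers yield the entries from last to first: in round `i`, scalar `20` holds the `i`-th
iterate of `prev`, and the position written is the last index minus `i`. -/
theorem runs_outProg {s : Mem} {F : ℕ} (hF : s.nat 11 0 = F) :
    Runs outProg s ((s.tables.index F + 1) * 50 + 50) fun s' =>
      s'.nat 2 0 = s.tables.index F + 1 ∧
      ∀ t ≤ s.tables.index F, s'.rat 2 t = s.tables.series F t := by
  refine Runs.mono (Runs.seq (T := 11) (Runs.mono (runs_of_wp
    (R := fun s' => s'.nat 2 0 = s.tables.index F + 1 ∧ s'.nat 20 0 = F) ?_)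
    (by simp [Program.bound, NExp.cost]) fun s₁ hA₁ ⟨h2, h20⟩ =>
    runs_forLoop (N := s.tables.index F + 1) (T := 20) (fun i s' =>
      s'.nat 2 0 = s.tables.index F + 1 ∧ s'.nat 20 0 = s.tables.prev^[i] F ∧
      ∀ t ≤ s.tables.index F, s.tables.index F < t + i → s'.rat 2 t = s.tables.series F t)
    ?_ ?_ ?_ ?_)) ?_ ?_
  · simp [Program.wp, NExp.eval, setNat_nat_of_ne, setNat_nat_self, hF, Mem.tables]
  · simp [Program.natWrites]
  · intro s' hA
    simp only [NExp.eval]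
    rw [hA.nat 2 (by simp [Program.natWrites]), h2]
  · refine ⟨?_, ?_, fun t _ _ => by omega⟩
    · rwa [setNat_nat_of_ne _ _ _ (by simp)]
    · rwa [setNat_nat_of_ne _ _ _ (by simp)]
  · intro i s' hi hA hi' ⟨g2, g20, gr⟩
    have e7 : s'.nat 7 = s.tables.prev := by
      rw [hA.nat 7 (by simp [Program.natWrites]), hA₁.nat 7 (by simp [Program.natWrites])]; rfl
    have e4 : s'.rat 4 = s.tables.last := by
      rw [hA.rat 4 (by simp [Program.ratWrites]), hA₁.rat 4 (by simp [Program.ratWrites])]; rfl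
    refine (runs_of_wp ?_).mono (by simp [Program.bound, NExp.cost, QExp.cost]) fun _ _ h => h
    simp only [Program.wp, NExp.eval, QExp.eval, setRat_nat, setNat_rat, setRat_rat_self,
      setNat_nat_of_ne _ _ _ (show 2 ≠ 16 by simp), setNat_nat_of_ne _ _ _ (show 2 ≠ 20 by simp),
      setNat_nat_of_ne _ _ _ (show 20 ≠ 16 by simp), setNat_nat_self, Function.update_self,
      e7, e4, g2, g20, hi', Function.iterate_succ_apply', true_and]
    intro t ht hlt
    by_cases he : t = s.tables.index F + 1 - (i + 1)
    · rw [← he, Function.update_self, Tables.series]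
      congr 2
      omega
    · rw [Function.update_of_ne he]
      exact gr t ht (by omega)
  · simp only [NExp.cost]; omega
  · rintro s' - ⟨g2, -, gr⟩
    exact ⟨g2, fun t ht => gr t ht (by omega)⟩

/-! ### Layout of the input -/

/-- Peeling off the first block shifts the offset of every later block by its length. -/
theorem getD_flatten_offset {α : Type*} (l : List (List α)) (d : α) (j i : ℕ)
    (hi : i < (l.getD j []).length) :
    l.flatten.getD (offset (fun t => (l.getD t []).length) j + i) d = (l.getD j []).getD i d := by
  induction l generalizing j with
  | nil => simp at hi
  | cons a l ih =>
    cases j with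
    | zero =>
      have hi' : i < a.length := by simpa using hi
      simp [offset, List.getElem?_append_left hi']
    | succ j =>
      have h := ih j (by simpa using hi)
      have e : offset (fun t => ((a :: l).getD t []).length) (j + 1) =
          a.length + offset (fun t => (l.getD t []).length) j := by
        simp [offset, Finset.sum_range_succ', add_comm]
      rw [e, add_assoc, List.flatten_cons, List.getD_append_right _ _ _ _ (Nat.le_add_right ..),
        Nat.add_sub_cancel_left, h]
      simp

theorem getD_ofFn_coe {α : Type*} {k : ℕ} (f : Fin k → α) (d : α) (j : Fin k) :
    (List.ofFn f).getD j d = f j := by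
  simp [List.getD_eq_getElem?_getD]

theorem inputMem_rat_one {k : ℕ} (x : Fin k → TimeSeries) (w : Fin k → ℚ) (j : Fin k) {i : ℕ}
    (hi : i < (x j).length) :
    (inputMem x w).rat 1 (offset ((inputMem x w).nat 1) j + i) = (x j).entry i := by
  have e : offset ((inputMem x w).nat 1) j =
      offset (fun t => ((List.ofFn fun j => List.ofFn (x j).val).getD t []).length) j := by
    refine Finset.sum_congr rfl fun t ht => ?_
    have ht' : t < k := (Finset.mem_range.1 ht).trans j.2
    simp [inputMem, ht']
  have h1 := getD_ofFn_coe (fun j => List.ofFn (x j).val) [] j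
  rw [e]
  have := getD_flatten_offset (List.ofFn fun j => List.ofFn (x j).val) (0 : ℚ) j i
    (by rw [h1]; simpa using hi)
  rw [h1] at this
  have h3 := getD_ofFn_coe (x j).val 0 ⟨i, hi⟩
  simp only at h3
  rw [h3] at this
  rw [TimeSeries.entry, dif_pos hi, ← this]
  simp [inputMem]

theorem sup_inputMem {k : ℕ} (x : Fin k → TimeSeries) (w : Fin k → ℚ) :
    (Finset.range k).sup ((inputMem x w).nat 1) = maxLength x := by
  have e : ∀ j : Fin k, (inputMem x w).nat 1 j = (x j).length := fun j =>
    getD_ofFn_coe (fun j => (x j).length) 0 j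
  refine le_antisymm (Finset.sup_le fun j hj => ?_) (Finset.sup_le fun j _ => ?_)
  · rw [e ⟨j, Finset.mem_range.1 hj⟩]
    exact Finset.le_sup (f := fun j => (x j).length) (Finset.mem_univ _)
  · rw [← e j]
    exact Finset.le_sup (Finset.mem_range.2 j.2)

/-! ### Total running time and conclusion -/

/-- After `i + 1 ≤ k * n`, and with `A = n ^ k` and `B = 2 ^ k`, every monomial on the left divides
the positive number `A * A * n * B * k`, hence is at most that; the coefficients add up to less than
`3000`. -/
theorem total_time_le {k n i : ℕ} (hk : 0 < k) (hn : 0 < n) (hi : i ≤ k * (n - 1)) :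
    n ^ k * (k * 40 + 80) + 2 ^ k * (k * 40 + 80) + k * 150 + 200 +
      (n ^ k * (n ^ k * (2 ^ k * (k * (n * 200 + 200) + 270) + 50) + k * (n * 200 + 200) + 350) +
        50 + ((i + 1) * 50 + 50)) ≤ 3000 * (n ^ (2 * k + 1) * 2 ^ k * k) := by
  have hi' : i + 1 ≤ k * n := by
    obtain ⟨m, rfl⟩ : ∃ m, n = m + 1 := ⟨n - 1, by omega⟩
    rw [Nat.add_sub_cancel] at hi
    rw [Nat.mul_succ]
    omega
  have hA : 0 < n ^ k := by positivity
  have hB : 0 < 2 ^ k := by positivity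
  have e : n ^ (2 * k + 1) = n ^ k * n ^ k * n := by ring
  rw [e]
  generalize n ^ k = A at *
  generalize 2 ^ k = B at *
  have h : ∀ x y, 0 < y → x * y = A * A * n * B * k → x ≤ A * A * n * B * k := fun x y hy he =>
    he ▸ Nat.le_mul_of_pos_right x hy
  have h1 := h 1 (A * A * n * B * k) (by positivity) (by ring)
  have h2 := h (A * k) (A * n * B) (by positivity) (by ring)
  have h3 := h A (A * n * B * k) (by positivity) (by ring)
  have h4 := h (B * k) (A * A * n) (by positivity) (by ring)
  have h5 := h B (A * A * n * k) (by positivity) (by ring)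
  have h6 := h k (A * A * n * B) (by positivity) (by ring)
  have h7 := h (A * A * B * k) n hn (by ring)
  have h8 := h (A * A * B) (n * k) (by positivity) (by ring)
  have h9 := h (A * A) (n * B * k) (by positivity) (by ring)
  have h10 := h (A * k * n) (A * B) (by positivity) (by ring)
  have h11 := h (k * n) (A * A * B) (by positivity) (by ring)
  nlinarith

end DTW

theorem theorem1 :
    ∃ (P : DTW.Program) (c : ℕ),
      ∀ (k : ℕ), 0 < k → ∀ (x : Fin k → DTW.TimeSeries) (w : Fin k → ℚ), (∀ j, 0 ≤ w j) →
        ∃ (t : ℕ) (s : DTW.Mem) (z : DTW.TimeSeries),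
          DTW.Exec P (DTW.inputMem x w) t s ∧
          DTW.IsOutput s z ∧
          DTW.IsMean x w z ∧
          t ≤ c * (DTW.maxLength x ^ (2 * k + 1) * 2 ^ k * k) := by
  open DTW in
  refine ⟨.seq prepProg (.seq tableProg outProg), 3000, fun k hk x w hw => ?_⟩
  set n := maxLength x with hn
  set L := (inputMem x w).nat 1 with hL
  set X : ℕ → ℕ → ℚ := fun j i => (inputMem x w).rat 1 (offset L j + i) with hX
  set w' := (inputMem x w).rat 0 with hw'
  set F := ofDigitFun n k fun j => L j - 1 with hF
  have eL : ∀ j : Fin k, L j = (x j).length := fun j =>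
    getD_ofFn_coe (fun j => (x j).length) 0 j
  have ew : ∀ j : Fin k, w' j = w j := fun j => getD_ofFn_coe w 0 j
  have hw0 : ∀ j < k, 0 ≤ w' j := fun j hj => ew ⟨j, hj⟩ ▸ hw ⟨j, hj⟩
  have hle : ∀ j : Fin k, (x j).length ≤ n := fun j =>
    Finset.le_sup (f := fun j => (x j).length) (Finset.mem_univ j)
  have hn0 : 0 < n := (x ⟨0, hk⟩).length_pos.trans_le (hle _)
  have hd : ∀ j < k, L j - 1 < n := fun j hj => by
    have h1 := hle ⟨j, hj⟩
    have h2 := (x ⟨j, hj⟩).length_pos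
    have h3 := eL ⟨j, hj⟩
    simp only at h3
    omega
  have hFn : F < n ^ k := ofDigitFun_lt hd
  have hk' : (inputMem x w).nat 0 0 = k := by simp [inputMem]
  have run : Runs (.seq prepProg (.seq tableProg outProg)) (inputMem x w)
      (3000 * (n ^ (2 * k + 1) * 2 ^ k * k)) fun s => ∃ t : Tables,
        (∀ Q < n ^ k, Good k n w' X t Q) ∧ s.nat 2 0 = t.index F + 1 ∧
        ∀ i ≤ t.index F, s.rat 2 i = t.series F i := by
    obtain ⟨t₁, s₁, he₁, ht₁, hs₁, hF₁⟩ := runs_prepProg hk' hk rfl (sup_inputMem x w) hn0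
    obtain ⟨t₂, s₂, he₂, ht₂, hs₂⟩ := runs_tableProg hn0 hs₁
    have hF₂ : s₂.nat 11 0 = F := by
      rw [he₂.agree.nat 11 (by simp [tableProg, stateProg, stepProg, recordProg, segProg, forLoop,
        Program.natWrites]), hF₁]
    obtain ⟨t₃, s₃, he₃, ht₃, h2, hr⟩ := runs_outProg hF₂
    have hi := Tables.index_le hn0 hFn fun Q hQ => hs₂ Q (hQ.trans_lt hFn)
    exact ⟨_, s₃, .seq he₁ (.seq he₂ he₃), (add_le_add ht₁ (add_le_add ht₂ ht₃)).trans
      (total_time_le hk hn0 hi), s₂.tables, hs₂, h2, hr⟩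
  obtain ⟨t, s, he, ht, T, hT, h2, hr⟩ := run
  have hT' : ∀ Q ≤ F, Good k n w' X T Q := fun Q hQ => hT Q (hQ.trans_lt hFn)
  have hdig : ∀ j < k, digit n F j = L j - 1 := fun j hj => digit_ofDigitFun hd hj
  -- The entries of `z` are by definition the output cells, so only its optimality remains to be
  -- checked.
  refine ⟨t, s, ⟨T.index F + 1, Nat.succ_pos _, fun i => s.rat 2 i⟩, he, ⟨h2, fun _ => rfl⟩, ?_, ht⟩
  refine isMean_of_reach hw ew (X := X) (p := digit n F) (fun j i hi => inputMem_rat_one x w j hi)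
    (fun j => by rw [hdig j j.2, eL j]) (v := T.opt F) ?_ fun y i u hu =>
      opt_le_of_reach hn0 hw0 hT' le_rfl hFn hu
  refine (reach_series hT').congr (fun i hi => ?_) fun _ _ => rfl
  simp [TimeSeries.entry, Nat.lt_succ_of_le hi, hr i hi]
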